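/- **Setting.** Let $d\ge 1$, let $Q$ be a transition probability on a measurable space $(E,\mathcal E)$ with invariant probability measure $\pi$, and let $\xi:E\to\mathbb R^d$ be measurable and $\pi$-integrable with $\pi(\xi)=0$. For $t\in\mathbb R^d$ let $(Q(t)f)(x)=\int_E e^{i\langle t,\xi(y)\rangle}f(y)\,Q(x,dy)$; thus $Q(0)=Q$. All Banach spaces $\mathcal B$ below are complex, consist either of $\pi$-integrable functions on $E$ or of classes of such functions modulo $\pi$, contain $1_E$, and embed continuously into $L^1(\pi)$. $\mathcal B\hookrightarrow X$ means that the identity map (or $f\mapsto$ class of $f$, if $\mathcal B$ consists of functions and $X$ of classes) is a continuous map $\mathcal B\to X$. $\mathcal L(\mathcal B,X)$ is the space of bounded operators, $\mathcal L(\mathcal B)=\mathcal L(\mathcal B,\mathcal B)$, and $\mathcal C^j(V,\mathcal B,X)$ is the set of maps from the open set $V\subset\mathbb R^d$ to $\mathcal L(\mathcal B,X)$ with $j$ continuous derivatives. For such a map $F$, $F^{(\ell)}$ denotes any partial derivative $\partial^\ell F/\partial t_{i_1}\cdots\partial t_{i_\ell}$. **Condition (K) on $\mathcal B$.** There is an open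 neighbourhood $\mathcal O$ of $0$ such that $Q(t)\in\mathcal L(\mathcal B)$ for $t\in\mathcal O$; $Q^n\to \pi(\cdot)1_E$ in the norm of $\mathcal L(\mathcal B)$; $\lim_{h\to0}\|Q(t+h)-Q(t)\|_{\mathcal B,L^1(\pi)}=0$ for all $t\in\mathcal O$; and there are $\kappa_1\in[0,1)$, $C>0$ with $\|Q(t)^nf\|_{\mathcal B}\le C\kappa_1^n\|f\|_{\mathcal B}+C\|f\|_{L^1(\pi)}$ for all $n\ge1$, $f\in\mathcal B$, $t\in\mathcal O$. **Hypothesis $\mathcal C(m)$** ($m\ge1$, $\mathcal B\hookrightarrow\widetilde{\mathcal B}$). There are $I\subset\mathbb R$, spaces $(\mathcal B_\theta)_{\theta\in I}$ with $\mathcal B_\theta\hookrightarrow\widetilde{\mathcal B}$ for all $\theta\in I$, and maps $T_0,T_1:I\to\mathbb R$ such that every $\theta\in I$ has an open neighbourhood $\mathcal V_\theta$ of $0$ in $\mathbb R^d$ with: (0) if $T_i(\theta)\in I$, then $\mathcal B_\theta\hookrightarrow\mathcal B_{T_i(\theta)}$ ($i=0,1$); (1) if $T_0(\theta)\in I$,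 then $Q(\cdot)\in\mathcal C^0(\mathcal V_\theta,\mathcal B_\theta,\mathcal B_{T_0(\theta)})$; (2) for $1\le j\le m$, if $\theta_j:=T_1(T_0T_1)^{j-1}(\theta)$ is defined and belongs to $I$, then $Q(\cdot)\in\mathcal C^j(\mathcal V_\theta,\mathcal B_\theta,\mathcal B_{\theta_j})$; (3) (K) holds on $\mathcal B_\theta$; and moreover (4) there is $a$ such that $(T_0T_1)^kT_0(a)\in I$ and $(T_1T_0)^k(a)\in I$ for $k=0,\dots,m$, with $\mathcal B=\mathcal B_a$ and $\widetilde{\mathcal B}=\mathcal B_{(T_0T_1)^mT_0(a)}$. For $\kappa\in(0,1)$ let $\mathcal D_\kappa=\{z\in\mathbb C:|z|\ge\kappa,\ |z-1|\ge(1-\kappa)/2\}$. **Statement.** Assume $\mathcal C(m)$. For every $\kappa_a\in(0,1)$ and every neighbourhood $\mathcal U_a$ of $0$ there are $\tilde\kappa\in(\kappa_a,1)$ and an open neighbourhood $\mathcal O\subset\mathcal U_a$ of $0$ such that, for all $t\in\mathcal O$ and $z\in\mathcal D_{\tilde\kappa}$, $Q(t)\in\mathcal L(\mathcal B)$ and $z-Q(t)$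 is invertible in $\mathcal L(\mathcal B)$, with inverse $R_z(t)$; $R_z(\cdot)\in\mathcal C^m(\mathcal O,\mathcal B,\widetilde{\mathcal B})$ for all $z\in\mathcal D_{\tilde\kappa}$; and $$\sup\{\|R_z^{(\ell)}(t)\|_{\mathcal B,\widetilde{\mathcal B}}:\ z\in\mathcal D_{\tilde\kappa},\ t\in\mathcal O\}<+\infty,\qquad \ell=0,\dots,m .$$ Moreover, there is an open neighbourhood $\mathcal V\subset\mathcal O$ of $0$ such that, for $t\in\mathcal V$, $Q(t)$ has on $\mathcal B$ a dominating eigenvalue $\lambda(t)$ with rank-one eigenprojection $\Pi(t)$ (that is, $\Pi(t)Q(t)=Q(t)\Pi(t)=\lambda(t)\Pi(t)$, and $N(t):=Q(t)-\lambda(t)\Pi(t)$ has spectral radius less than $|\lambda(t)|$ on $\mathcal B$), and (i) $\Pi(\cdot)\in\mathcal C^m(\mathcal V,\mathcal B,\widetilde{\mathcal B})$; (ii) $N_n(\cdot):=N(\cdot)^n\in\mathcal C^m(\mathcal V,\mathcal B,\widetilde{\mathcal B})$ for all $n\ge1$, and there is $C>0$ such that $\sup_{t\in\mathcal V}\|N_n^{(\ell)}(t)\|_{\mathcal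 B,\widetilde{\mathcal B}}\le C\tilde\kappa^n$ for all $n\ge1$ and $\ell=0,\dots,m$; (iii) $\lambda(\cdot)\in\mathcal C^m(\mathcal V,\mathbb C)$. -/

import Mathlib

open MeasureTheory ProbabilityTheory Filter Topology Set

universe u

noncomputable section

/-- A Banach space of complex functions on the probability space `(E, π)`: either a vector space
of genuine `π`-integrable functions (`eqv = ⊤`: two functions are identified when they agree
everywhere) or a vector space of classes of `π`-integrable functions modulo `π`
(`eqv = ae π`: two functions are identified when they agree `π`-almost everywhere; `toFn f` is
then some representative of `f`). It carries a complete norm, contains the constant function `1`,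
and embeds continuously into `L¹(π)`. -/
structure FunctionSpace {E : Type u} [MeasurableSpace E] (π : Measure E) where
  carrier : Type u
  [normedAddCommGroup : NormedAddCommGroup carrier]
  [normedSpace : NormedSpace ℂ carrier]
  [completeSpace : CompleteSpace carrier]
  eqv : Filter E
  eqv_eq : eqv = ⊤ ∨ eqv = ae π
  toFn : carrier → E → ℂ
  toFn_add : ∀ f g, toFn (f + g) =ᶠ[eqv] fun x => toFn f x + toFn g x
  toFn_smul : ∀ (c : ℂ) f, toFn (c • f) =ᶠ[eqv] fun x => c * toFn f x
  toFn_inj : ∀ f g, toFn f =ᶠ[eqv] toFn g → f = g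
  integrable : ∀ f, Integrable (toFn f) π
  one_mem : ∃ e, toFn e =ᶠ[eqv] fun _ => 1
  embeds_L1 : ∃ C : ℝ, ∀ f, ∫ x, ‖toFn f x‖ ∂π ≤ C * ‖f‖

attribute [instance] FunctionSpace.normedAddCommGroup
attribute [instance] FunctionSpace.normedSpace
attribute [instance] FunctionSpace.completeSpace

instance {E : Type u} [MeasurableSpace E] (π : Measure E) :
    CoeSort (FunctionSpace π) (Type u) := ⟨FunctionSpace.carrier⟩

section

variable {E : Type u} [MeasurableSpace E] {π : Measure E} {d : ℕ}

/-- The norm of `L¹(π)`, on the elements of `B`. -/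
def FunctionSpace.normL1 (B : FunctionSpace π) (f : B) : ℝ := ∫ x, ‖B.toFn f x‖ ∂π

/-- `ι` is the identity map from `B` into `X` (or `f ↦ Cl(f)`, when `B` consists of functions and
`X` of classes). -/
def IsInclusion (B X : FunctionSpace π) (ι : B →L[ℂ] X) : Prop :=
  X.eqv ≤ B.eqv ∧ ∀ f, X.toFn (ι f) =ᶠ[X.eqv] B.toFn f

/-- The continuous embedding `B ↪ X`. -/
def Embeds (B X : FunctionSpace π) : Prop := ∃ ι : B →L[ℂ] X, IsInclusion B X ι

/-- The identity map of a continuous embedding `B ↪ X`. -/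
def Embeds.incl {B X : FunctionSpace π} (h : Embeds B X) : B →L[ℂ] X := h.choose

/-- `(Q(t) f)(x) = ∫ e^{i⟨t, ξ(y)⟩} f(y) Q(x, dy)`. -/
def fourierKernel (Q : Kernel E E) (ξ : E → EuclideanSpace ℝ (Fin d))
    (t : EuclideanSpace ℝ (Fin d)) (f : E → ℂ) (x : E) : ℂ :=
  ∫ y, Complex.exp (Complex.I * ((inner ℝ t (ξ y) : ℝ) : ℂ)) * f y ∂(Q x)

/-- The bounded operator `T : B → X` is the one defined by the kernel `Q(t)`. -/
def IsFourierOp (Q : Kernel E E) (ξ : E → EuclideanSpace ℝ (Fin d)) (B X : FunctionSpace π)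
    (t : EuclideanSpace ℝ (Fin d)) (T : B →L[ℂ] X) : Prop :=
  ∀ f, X.toFn (T f) =ᶠ[X.eqv] fourierKernel Q ξ t (B.toFn f)

/-- `Q(t) ∈ 𝓛(B, X)`. -/
def FourierActs (Q : Kernel E E) (ξ : E → EuclideanSpace ℝ (Fin d)) (B X : FunctionSpace π)
    (t : EuclideanSpace ℝ (Fin d)) : Prop :=
  ∃ T : B →L[ℂ] X, IsFourierOp Q ξ B X t T

open Classical in
/-- The operator `Q(t)` as an element of `𝓛(B, X)` (and `0` if `Q(t) ∉ 𝓛(B, X)`). -/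
def fourierOp (Q : Kernel E E) (ξ : E → EuclideanSpace ℝ (Fin d)) (B X : FunctionSpace π)
    (t : EuclideanSpace ℝ (Fin d)) : B →L[ℂ] X :=
  if h : FourierActs Q ξ B X t then h.choose else 0

/-- `Q(·) ∈ 𝒞^j(V, B, X)`. -/
def FourierContDiffOn (Q : Kernel E E) (ξ : E → EuclideanSpace ℝ (Fin d)) (j : ℕ)
    (V : Set (EuclideanSpace ℝ (Fin d))) (B X : FunctionSpace π) : Prop :=
  (∀ t ∈ V, FourierActs Q ξ B X t) ∧ ContDiffOn ℝ j (fourierOp Q ξ B X) V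

/-- Condition (K) on `B`: strong ergodicity of `Q = Q(0)` on `B`, continuity of `t ↦ Q(t)` from a
neighbourhood of `0` to `𝓛(B, L¹(π))`, and a uniform Doeblin-Fortet inequality. -/
def HypothesisK (Q : Kernel E E) (ξ : E → EuclideanSpace ℝ (Fin d)) (B : FunctionSpace π) : Prop :=
  ∃ O : Set (EuclideanSpace ℝ (Fin d)), IsOpen O ∧ 0 ∈ O ∧
    (∀ t ∈ O, FourierActs Q ξ B B t) ∧
    (∃ P : B →L[ℂ] B, (∀ f, B.toFn (P f) =ᶠ[B.eqv] fun _ => ∫ y, B.toFn f y ∂π) ∧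
      Tendsto (fun n : ℕ => ‖fourierOp Q ξ B B 0 ^ n - P‖) atTop (𝓝 0)) ∧
    (∀ t ∈ O, ∀ ε > 0, ∀ᶠ h in 𝓝 (0 : EuclideanSpace ℝ (Fin d)), ∀ f : B,
      B.normL1 (fourierOp Q ξ B B (t + h) f - fourierOp Q ξ B B t f) ≤ ε * ‖f‖) ∧
    (∃ κ₁ C : ℝ, 0 ≤ κ₁ ∧ κ₁ < 1 ∧ 0 < C ∧ ∀ n : ℕ, 1 ≤ n → ∀ f : B, ∀ t ∈ O,
      ‖(fourierOp Q ξ B B t ^ n) f‖ ≤ C * κ₁ ^ n * ‖f‖ + C * B.normL1 f)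

/-- Hypothesis `𝒞(m)` for the pair `B ↪ B'`. The family `(Bθ)` and the maps `T₀, T₁` are only used
at points of `I`, so their values elsewhere are irrelevant; in particular the requirement on
`Q(·)` for the `j`-th derivative is imposed only if `T₁ (T₀ T₁)^{j-1} θ` is a point of `I` that is
reached from `θ` inside `I`. -/
def HypothesisC (Q : Kernel E E) (ξ : E → EuclideanSpace ℝ (Fin d)) (m : ℕ)
    (B B' : FunctionSpace π) : Prop :=
  ∃ (I : Set ℝ) (Bθ : ℝ → FunctionSpace π) (T₀ T₁ : ℝ → ℝ),
    (∀ θ ∈ I, Embeds (Bθ θ) B') ∧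
    (∀ θ ∈ I, ∃ V : Set (EuclideanSpace ℝ (Fin d)), IsOpen V ∧ 0 ∈ V ∧
      (T₀ θ ∈ I → Embeds (Bθ θ) (Bθ (T₀ θ))) ∧
      (T₁ θ ∈ I → Embeds (Bθ θ) (Bθ (T₁ θ))) ∧
      (T₀ θ ∈ I → FourierContDiffOn Q ξ 0 V (Bθ θ) (Bθ (T₀ θ))) ∧
      (∀ j : ℕ, 1 ≤ j → j ≤ m →
        (∀ i < j, (T₀ ∘ T₁)^[i] θ ∈ I ∧ T₁ ((T₀ ∘ T₁)^[i] θ) ∈ I) →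
        FourierContDiffOn Q ξ j V (Bθ θ) (Bθ (T₁ ((T₀ ∘ T₁)^[j - 1] θ)))) ∧
      HypothesisK Q ξ (Bθ θ)) ∧
    ∃ a : ℝ, (∀ k ≤ m, (T₀ ∘ T₁)^[k] (T₀ a) ∈ I ∧ (T₁ ∘ T₀)^[k] a ∈ I) ∧
      B = Bθ a ∧ B' = Bθ ((T₀ ∘ T₁)^[m] (T₀ a))

/-- `𝒟_κ = {z : |z| ≥ κ, |z - 1| ≥ (1 - κ)/2}`. -/
def resolventDomain (κ : ℝ) : Set ℂ := {z | κ ≤ ‖z‖ ∧ (1 - κ) / 2 ≤ ‖z - 1‖}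

/-- The partial derivative `∂^ℓ F / ∂t_{i 0} ⋯ ∂t_{i (ℓ-1)}` at `t` (of a function of class `C^ℓ`
near `t`). -/
def partialDeriv {X : Type*} [NormedAddCommGroup X] [NormedSpace ℝ X] (ℓ : ℕ) (i : Fin ℓ → Fin d)
    (F : EuclideanSpace ℝ (Fin d) → X) (t : EuclideanSpace ℝ (Fin d)) : X :=
  iteratedFDeriv ℝ ℓ F t (fun k => EuclideanSpace.single (i k) (1 : ℝ))

/-- `lam` is the dominating eigenvalue of `T`, and `P` the associated rank-one eigenprojection:
`P` is a projection of rank one with `T P = P T = lam P`, and the remaining part `T - lam P` of `T`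
has spectral radius smaller than `|lam|`. Such a pair is unique. -/
def IsDominatingEigenpair {X : Type*} [NormedAddCommGroup X] [NormedSpace ℂ X]
    (T : X →L[ℂ] X) (lam : ℂ) (P : X →L[ℂ] X) : Prop :=
  P * P = P ∧ Module.finrank ℂ P.range = 1 ∧ T * P = lam • P ∧ P * T = lam • P ∧
    spectralRadius ℂ (T - lam • P) < (‖lam‖₊ : ENNReal)

end

end

/-! The points `a, T₀ a, T₁ T₀ a, …` of the hypothesis give a chain of spaces `S 0 = B, …, S (2m+1)
= B'`. On it `Q(·)` is continuous from `S i` to `S (i+1)` for even `i`, and of class `C^l` from `S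
i` to `S (i+2l-1)` for odd `i`. Three ideas are combined.

Uniform resolvent bounds. On each `S i`, (K) gives a Doeblin–Fortet inequality whose weak seminorm
is the `L¹(π)` norm, contracted by every `Q(t)` because `π` is invariant. The Keller–Liverani
argument (`keller_liverani`) then bounds `(z - Q(t))⁻¹` on `𝒟_κ` uniformly for `t` near `0`, and
shows weak convergence to `(z - Q)⁻¹`.

Smoothness. The identity `R(s) - R(t) = R(s) (Q(s) - Q(t)) R(t)`, with each factor placed on a
suitable space, shows that `R` is continuous at the cost of one space and that `R' = R Q' R` at the
cost of three. Induction with a Leibniz rule adapted to the chain (`contDiffOn_comp_of_graded`)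
gives `l` derivatives for `2l+1` spaces (`ResolventScale.contDiffOn_r`). Uniformity in `z` comes for
free: the argument is run with `S i` replaced by bounded continuous functions `𝒟_κ → S i`, on which
the resolvents act as one diagonal operator. A single `C^m` function of `t` then carries all `z` at
once.

Spectral part. The moments `J_n(t) = (2πi)⁻¹ ∮ zⁿ (z - Q(t))⁻¹ dz` over `|z| = κ` are continuous
linear images of that function, of norm at most `κ · κⁿ`. One has `Π = 1 - J_0` and `Nⁿ = J_n`,
while `λ = π(QΠ1)/π(Π1)` with `QΠ1 = Q1 - J_1 1`. Regularity and the geometric bounds follow. That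
`Π(t)` has rank one is proved by comparing `J_0(t)` with `J_0(0)` in the weak seminorm
(`eventually_isDominatingEigenpair`). -/

noncomputable section

/-! ### Derivatives of products of operator-valued functions -/

section GradedProduct

variable {V : Type*} [NormedAddCommGroup V] [NormedSpace ℝ V]

/-- Left composition, as a real-linear map. -/
def compLeftReal {X Y Z : Type*} [NormedAddCommGroup X] [NormedSpace ℂ X] [NormedAddCommGroup Y]
    [NormedSpace ℂ Y] [NormedAddCommGroup Z] [NormedSpace ℂ Z] (A : Y →L[ℂ] Z) :
    (X →L[ℂ] Y) →L[ℝ] (X →L[ℂ] Z) :=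
  ((ContinuousLinearMap.compL ℂ X Y Z) A).restrictScalars ℝ

/-- Right composition, as a real-linear map. -/
def compRightReal {X Y Z : Type*} [NormedAddCommGroup X] [NormedSpace ℂ X] [NormedAddCommGroup Y]
    [NormedSpace ℂ Y] [NormedAddCommGroup Z] [NormedSpace ℂ Z] (B : X →L[ℂ] Y) :
    (Y →L[ℂ] Z) →L[ℝ] (X →L[ℂ] Z) :=
  ((ContinuousLinearMap.compL ℂ X Y Z).flip B).restrictScalars ℝ

section

variable {X Y Z : Type*} [NormedAddCommGroup X] [NormedSpace ℂ X] [NormedAddCommGroup Y]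
  [NormedSpace ℂ Y] [NormedAddCommGroup Z] [NormedSpace ℂ Z]

@[simp] theorem compLeftReal_apply (A : Y →L[ℂ] Z) (B : X →L[ℂ] Y) :
    compLeftReal A B = A ∘L B := rfl

@[simp] theorem compRightReal_apply (A : Y →L[ℂ] Z) (B : X →L[ℂ] Y) :
    compRightReal B A = A ∘L B := rfl

theorem ContDiffOn.comp_op_left {n : WithTop ℕ∞} {O : Set V} {F : V → X →L[ℂ] Y}
    (hF : ContDiffOn ℝ n F O) (A : Y →L[ℂ] Z) : ContDiffOn ℝ n (fun t => A ∘L F t) O :=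
  (compLeftReal (X := X) A).contDiff.comp_contDiffOn hF

theorem ContDiffOn.comp_op_right {n : WithTop ℕ∞} {O : Set V} {F : V → Y →L[ℂ] Z}
    (hF : ContDiffOn ℝ n F O) (B : X →L[ℂ] Y) : ContDiffOn ℝ n (fun t => F t ∘L B) O :=
  (compRightReal (Z := Z) B).contDiff.comp_contDiffOn hF

theorem HasFDerivAt.comp_op_left {F : V → X →L[ℂ] Y} {F' : V →L[ℝ] (X →L[ℂ] Y)} {t : V}
    (hF : HasFDerivAt F F' t) (A : Y →L[ℂ] Z) :
    HasFDerivAt (fun t => A ∘L F t) ((compLeftReal A).comp F') t :=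
  (compLeftReal (X := X) A).hasFDerivAt.comp t hF

theorem HasFDerivAt.comp_op_right {F : V → Y →L[ℂ] Z} {F' : V →L[ℝ] (Y →L[ℂ] Z)} {t : V}
    (hF : HasFDerivAt F F' t) (B : X →L[ℂ] Y) :
    HasFDerivAt (fun t => F t ∘L B) ((compRightReal B).comp F') t :=
  (compRightReal (Z := Z) B).hasFDerivAt.comp t hF

/-- The product of a continuous function and of a function that is differentiable and vanishes
at `t` is differentiable at `t`. -/
theorem HasFDerivAt.continuousAt_comp_of_eq_zero {c : V → Y →L[ℂ] Z} {w : V → X →L[ℂ] Y}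
    {w' : V →L[ℝ] (X →L[ℂ] Y)} {t : V} (hc : ContinuousAt c t) (hw : HasFDerivAt w w' t)
    (h0 : w t = 0) :
    HasFDerivAt (fun s => c s ∘L w s) ((compLeftReal (c t)).comp w') t := by
  have h1 : HasFDerivAt (fun s => c t ∘L w s) ((compLeftReal (c t)).comp w') t :=
    hw.comp_op_left (c t)
  have h2 : HasFDerivAt (fun s => (c s - c t) ∘L w s) (0 : V →L[ℝ] (X →L[ℂ] Z)) t := by
    rw [hasFDerivAt_iff_isLittleO]
    have hbig : (fun s => w s) =O[𝓝 t] fun s => s - t := by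
      simpa [h0] using hw.isBigO_sub
    have hlit : (fun s => c s - c t) =o[𝓝 t] fun _ => (1 : ℝ) := by
      rw [Asymptotics.isLittleO_one_iff]
      exact tendsto_sub_nhds_zero_iff.2 hc.tendsto
    have : (fun s => (c s - c t) ∘L w s) =o[𝓝 t] fun s => s - t := by
      have h3 : (fun s => ‖c s - c t‖ * ‖w s‖) =o[𝓝 t] fun s => (1 : ℝ) * ‖s - t‖ :=
        hlit.norm_left.mul_isBigO hbig.norm_norm
      simp only [one_mul] at h3
      refine (Asymptotics.IsBigO.trans_isLittleO ?_ h3).of_norm_right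
      exact Asymptotics.IsBigO.of_bound 1 (Eventually.of_forall fun s => by
        rw [one_mul, Real.norm_of_nonneg (by positivity)]
        exact ContinuousLinearMap.opNorm_comp_le _ _)
    simpa [h0] using this
  have := h1.add h2
  rw [add_zero] at this
  refine this.congr_of_eventuallyEq (Eventually.of_forall fun s => ?_)
  simp [ContinuousLinearMap.sub_comp]

end

/-- In finite dimension the smoothness of a derivative can be tested in each direction `v`
separately; inductions on the order thus stay among functions with values in the same space. -/
theorem contDiffOn_succ_of_hasFDerivAt [FiniteDimensional ℝ V] {X : Type*}
    [NormedAddCommGroup X] [NormedSpace ℝ X]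
    {n : ℕ} {O : Set V} (hO : IsOpen O) {f : V → X} {f' : V → V →L[ℝ] X}
    (h : ∀ t ∈ O, HasFDerivAt f (f' t) t)
    (h' : ∀ v, ContDiffOn ℝ n (fun t => f' t v) O) : ContDiffOn ℝ (n + 1 : ℕ) f O := by
  rw [Nat.cast_add, Nat.cast_one, contDiffOn_succ_iff_fderiv_apply hO.uniqueDiffOn]
  refine ⟨fun t ht => (h t ht).differentiableAt.differentiableWithinAt, by simp, fun v => ?_⟩
  refine (h' v).congr fun t ht => ?_
  rw [fderivWithin_of_isOpen hO ht, (h t ht).fderiv]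

theorem ContDiffOn.fderiv_apply_succ [FiniteDimensional ℝ V] {X : Type*}
    [NormedAddCommGroup X] [NormedSpace ℝ X]
    {n : ℕ} {O : Set V} (hO : IsOpen O) {f : V → X} (h : ContDiffOn ℝ (n + 1 : ℕ) f O) (v : V) :
    ContDiffOn ℝ n (fun t => fderiv ℝ f t v) O := by
  rw [Nat.cast_add, Nat.cast_one, contDiffOn_succ_iff_fderiv_apply hO.uniqueDiffOn] at h
  refine (h.2.2 v).congr fun t ht => ?_
  rw [fderivWithin_of_isOpen hO ht]

theorem ContDiffOn.hasFDerivAt_of_isOpen {X : Type*} [NormedAddCommGroup X] [NormedSpace ℝ X]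
    {n : ℕ} {O : Set V} (hO : IsOpen O) {f : V → X} (h : ContDiffOn ℝ n f O) (hn : 1 ≤ n)
    {t : V} (ht : t ∈ O) : HasFDerivAt f (fderiv ℝ f t) t :=
  ((h.differentiableOn (by simpa using by omega)).differentiableAt (hO.mem_nhds ht)).hasFDerivAt

theorem fderiv_eq_comp_op_left {X Y Z : Type*} [NormedAddCommGroup X] [NormedSpace ℂ X]
    [NormedAddCommGroup Y] [NormedSpace ℂ Y] [NormedAddCommGroup Z] [NormedSpace ℂ Z]
    {O : Set V} (hO : IsOpen O) {F : V → X →L[ℂ] Y} {G : V → X →L[ℂ] Z} {A : Y →L[ℂ] Z}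
    (h : ∀ t ∈ O, G t = A ∘L F t) {t : V} (ht : t ∈ O) (hF : DifferentiableAt ℝ F t) (v : V) :
    fderiv ℝ G t v = A ∘L fderiv ℝ F t v := by
  have h1 : HasFDerivAt (fun s => A ∘L F s) ((compLeftReal A).comp (fderiv ℝ F t)) t :=
    hF.hasFDerivAt.comp_op_left A
  have h2 : G =ᶠ[𝓝 t] fun s => A ∘L F s := by
    filter_upwards [hO.mem_nhds ht] with s hs using h s hs
  rw [h2.fderiv_eq, h1.fderiv]
  rfl

theorem fderiv_eq_comp_op_right {X Y Z : Type*} [NormedAddCommGroup X] [NormedSpace ℂ X]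
    [NormedAddCommGroup Y] [NormedSpace ℂ Y] [NormedAddCommGroup Z] [NormedSpace ℂ Z]
    {O : Set V} (hO : IsOpen O) {F : V → Y →L[ℂ] Z} {G : V → X →L[ℂ] Z} {A : X →L[ℂ] Y}
    (h : ∀ t ∈ O, G t = F t ∘L A) {t : V} (ht : t ∈ O) (hF : DifferentiableAt ℝ F t) (v : V) :
    fderiv ℝ G t v = fderiv ℝ F t v ∘L A := by
  have h1 : HasFDerivAt (fun s => F s ∘L A) ((compRightReal A).comp (fderiv ℝ F t)) t :=
    hF.hasFDerivAt.comp_op_right A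
  have h2 : G =ᶠ[𝓝 t] fun s => F s ∘L A := by
    filter_upwards [hO.mem_nhds ht] with s hs using h s hs
  rw [h2.fderiv_eq, h1.fderiv]
  rfl

/-- If `F` loses one space of the scale `(Y i)` for each derivative, and `G` is of class `C^(n-i)`
on `Y i`, then the product is of class `C^n`. -/
theorem contDiffOn_comp_of_graded [FiniteDimensional ℝ V] {X Z : Type u}
    [NormedAddCommGroup X] [NormedSpace ℂ X]
    [NormedAddCommGroup Z] [NormedSpace ℂ Z] {O : Set V} (hO : IsOpen O) (n : ℕ) :
    ∀ {Y : ℕ → Type u} [∀ i, NormedAddCommGroup (Y i)] [∀ i, NormedSpace ℂ (Y i)]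
      (j : ∀ i, Y i →L[ℂ] Y (i + 1)) (F : ∀ i, V → X →L[ℂ] Y i) (G : ∀ i, V → Y i →L[ℂ] Z),
      (∀ i ≤ n, ContDiffOn ℝ i (F i) O) → (∀ i ≤ n, ContDiffOn ℝ (n - i : ℕ) (G i) O) →
      (∀ i < n, ∀ t ∈ O, F (i + 1) t = j i ∘L F i t) →
      (∀ i < n, ∀ t ∈ O, G i t = G (i + 1) t ∘L j i) →
      ContDiffOn ℝ n (fun t => G 0 t ∘L F 0 t) O := by
  induction n with
  | zero =>
    intro Y _ _ j F G hF hG _ _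
    have h1 := hF 0 le_rfl
    have h2 := hG 0 le_rfl
    simp only [Nat.cast_zero, Nat.sub_zero, contDiffOn_zero] at h1 h2 ⊢
    exact h2.clm_comp h1
  | succ n ih =>
    intro Y _ _ j F G hF hG hjF hjG
    have hF1 : ∀ t ∈ O, HasFDerivAt (F 1) (fderiv ℝ (F 1) t) t := fun t ht =>
      (hF 1 (by omega)).hasFDerivAt_of_isOpen hO le_rfl ht
    have hG0 : ∀ t ∈ O, HasFDerivAt (G 0) (fderiv ℝ (G 0) t) t := fun t ht =>
      (hG 0 (by omega)).hasFDerivAt_of_isOpen hO (by omega) ht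
    have hG1 : ∀ t ∈ O, ContinuousAt (G 1) t := fun t ht =>
      (hG 1 (by omega)).continuousOn.continuousAt (hO.mem_nhds ht)
    -- `G 0 s F 0 s - G 0 t F 0 t = G 1 s (F 1 s - F 1 t) + (G 0 s - G 0 t) F 0 t`: the increment of
    -- `F` is taken in `Y 1`, where `F` is differentiable; there `G` may be merely continuous.
    refine contDiffOn_succ_of_hasFDerivAt hO (f' := fun t =>
      (compLeftReal (G 1 t)).comp (fderiv ℝ (F 1) t) +
        (compRightReal (F 0 t)).comp (fderiv ℝ (G 0) t)) ?_ ?_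
    · intro t ht
      have h1 := HasFDerivAt.continuousAt_comp_of_eq_zero (hG1 t ht)
        ((hF1 t ht).sub_const (F 1 t)) (sub_self _)
      have h2 : HasFDerivAt (fun s => G 0 s ∘L F 0 t) _ t :=
        (hG0 t ht).comp_op_right (F 0 t)
      refine (h1.add h2).congr_of_eventuallyEq ?_
      filter_upwards [hO.mem_nhds ht] with s hs
      simp only [Pi.add_apply, ContinuousLinearMap.comp_sub]
      rw [hjF 0 (by omega) s hs, hjF 0 (by omega) t ht, ← ContinuousLinearMap.comp_assoc,
        ← ContinuousLinearMap.comp_assoc, ← hjG 0 (by omega) s hs]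
      simp
    · intro v
      -- Differentiating `F` shifts the grading by one; differentiating `G` (`h2`) leaves it in
      -- place and lowers the order of `G` by one.
      have h1 := ih (Y := fun i => Y (i + 1)) (fun i => j (i + 1))
        (fun i t => fderiv ℝ (F (i + 1)) t v) (fun i => G (i + 1))
        (fun i hi => (hF (i + 1) (by omega)).fderiv_apply_succ hO v)
        (fun i hi => by simpa using hG (i + 1) (by omega))
        (fun i hi t ht => fderiv_eq_comp_op_left hO (hjF (i + 1) (by omega)) ht
          ((hF (i + 1) (by omega)).hasFDerivAt_of_isOpen hO (by omega) ht).differentiableAt v)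
        (fun i hi => hjG (i + 1) (by omega))
      have h2 := ih (Y := Y) j F (fun i t => fderiv ℝ (G i) t v)
        (fun i hi => hF i (by omega))
        (fun i hi => by
          refine ContDiffOn.fderiv_apply_succ hO ?_ v
          have := hG i (by omega)
          rwa [show n + 1 - i = n - i + 1 by omega] at this)
        (fun i hi => hjF i (by omega))
        (fun i hi t ht => fderiv_eq_comp_op_right hO (hjG i (by omega)) ht
          ((hG (i + 1) (by omega)).hasFDerivAt_of_isOpen hO (by omega) ht).differentiableAt v)
      exact h1.add h2

end GradedProduct

/-! ### Resolvents acting on a scale of Banach spaces -/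

section ResolventScale

variable {V : Type*} [NormedAddCommGroup V] [NormedSpace ℝ V]

/-- A scale of spaces `S 0 → S 1 → ⋯ → S N` with operators `q i t` and `r i t` on `S i` which
satisfy the resolvent identity; `q` is continuous as a map into the next space, and loses an odd
number of spaces, starting at an odd index, for its derivatives. -/
structure ResolventScale {S : ℕ → Type u} [∀ i, NormedAddCommGroup (S i)]
    [∀ i, NormedSpace ℂ (S i)] (N : ℕ) (O : Set V) (inc : ∀ i k, S i →L[ℂ] S k)
    (q r : ∀ i, V → S i →L[ℂ] S i) : Prop where
  isOpen : IsOpen O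
  inc_self : ∀ i ≤ N, inc i i = .id ℂ (S i)
  inc_comp : ∀ i k l, i ≤ k → k ≤ l → l ≤ N → inc k l ∘L inc i k = inc i l
  q_inc : ∀ i k, i ≤ k → k ≤ N → ∀ t ∈ O, q k t ∘L inc i k = inc i k ∘L q i t
  r_inc : ∀ i k, i ≤ k → k ≤ N → ∀ t ∈ O, r k t ∘L inc i k = inc i k ∘L r i t
  r_bdd : ∀ i ≤ N, ∃ M : ℝ, ∀ t ∈ O, ‖r i t‖ ≤ M
  resolvent_eq : ∀ i ≤ N, ∀ s ∈ O, ∀ t ∈ O, r i s - r i t = r i s ∘L (q i s - q i t) ∘L r i t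
  q_cont : ∀ i, Even i → i + 1 ≤ N → ContinuousOn (fun t => inc i (i + 1) ∘L q i t) O
  q_contDiff : ∀ i l k : ℕ, Odd i → 1 ≤ l → k + 1 = i + 2 * l → k ≤ N →
    ContDiffOn ℝ l (fun t => inc i k ∘L q i t) O

namespace ResolventScale

variable {S : ℕ → Type u} [∀ i, NormedAddCommGroup (S i)]
    [∀ i, NormedSpace ℂ (S i)] {N : ℕ} {O : Set V} {inc : ∀ i k, S i →L[ℂ] S k}
    {q r : ∀ i, V → S i →L[ℂ] S i}

/-- In `R(s) - R(t) = R(s) (Q(s) - Q(t)) R(t)` the left factor is moved to `S (i + 1)`, the space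
into which `q` is continuous. Only its boundedness is needed there. -/
theorem continuousOn_r (h : ResolventScale N O inc q r) {i : ℕ} (hi : Even i) (hiN : i + 1 ≤ N) :
    ContinuousOn (fun t => inc i (i + 1) ∘L r i t) O := by
  intro t ht
  obtain ⟨M, hM⟩ := h.r_bdd (i + 1) hiN
  have hq := h.q_cont i hi hiN t ht
  rw [ContinuousWithinAt, tendsto_iff_norm_sub_tendsto_zero] at hq ⊢
  have h0 : Tendsto (fun s => M * ‖inc i (i + 1) ∘L q i s - inc i (i + 1) ∘L q i t‖ * ‖r i t‖)
      (𝓝[O] t) (𝓝 0) := by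
    simpa using (hq.const_mul M).mul_const ‖r i t‖
  refine squeeze_zero' (Eventually.of_forall fun s => norm_nonneg _) ?_ h0
  filter_upwards [self_mem_nhdsWithin] with s hs
  have : inc i (i + 1) ∘L r i s - inc i (i + 1) ∘L r i t
      = r (i + 1) s ∘L ((inc i (i + 1) ∘L q i s - inc i (i + 1) ∘L q i t) ∘L r i t) := by
    rw [← ContinuousLinearMap.comp_sub, h.resolvent_eq i (by omega) s hs t ht,
      ← ContinuousLinearMap.comp_assoc, ← h.r_inc i (i + 1) (by omega) hiN s hs,
      ← ContinuousLinearMap.comp_sub]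
    simp only [ContinuousLinearMap.comp_assoc]
  rw [this, mul_assoc]
  exact (ContinuousLinearMap.opNorm_comp_le _ _).trans (mul_le_mul (hM s hs)
    (ContinuousLinearMap.opNorm_comp_le _ _) (norm_nonneg _) ((norm_nonneg _).trans (hM s hs)))

/-- The derivative of `q` from `S p` into `S (p + 1)`, for odd `p`. -/
def dq (inc : ∀ i k, S i →L[ℂ] S k) (q : ∀ i, V → S i →L[ℂ] S i) (p : ℕ) (v t : V) :
    S p →L[ℂ] S (p + 1) :=
  fderiv ℝ (fun t => inc p (p + 1) ∘L q p t) t v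

theorem hasFDerivAt_q (h : ResolventScale N O inc q r) {p : ℕ} (hp : Odd p) (hpN : p + 1 ≤ N)
    {t : V} (ht : t ∈ O) :
    HasFDerivAt (fun t => inc p (p + 1) ∘L q p t)
      (fderiv ℝ (fun t => inc p (p + 1) ∘L q p t) t) t :=
  (h.q_contDiff p 1 (p + 1) hp le_rfl (by omega) hpN).hasFDerivAt_of_isOpen h.isOpen le_rfl ht

/-- The derivative taken in `S (p + 1)` and then included in `S k` is the derivative taken directly
in `S k`, where `q` is of class `C^(l+1)`. -/
theorem contDiffOn_dq [FiniteDimensional ℝ V] (h : ResolventScale N O inc q r) {p : ℕ} (hp : Odd p) (l k : ℕ)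
    (hk : k = p + 1 + 2 * l) (hkN : k ≤ N) (v : V) :
    ContDiffOn ℝ l (fun t => inc (p + 1) k ∘L dq inc q p v t) O := by
  refine ((h.q_contDiff p (l + 1) k hp (by omega) (by omega) hkN).fderiv_apply_succ h.isOpen
    v).congr fun t ht => ?_
  symm
  refine fderiv_eq_comp_op_left h.isOpen (F := fun t => inc p (p + 1) ∘L q p t) (fun s hs => ?_) ht
    (h.hasFDerivAt_q hp (by omega) ht).differentiableAt v
  rw [← ContinuousLinearMap.comp_assoc, h.inc_comp p (p + 1) k (by omega) (by omega) hkN]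

/-- Both sides are the derivative of one map `S p → S (p + 3)`, factored through an inclusion on the
right or on the left. -/
theorem dq_inc (h : ResolventScale N O inc q r) {p : ℕ} (hp : Odd p) (hpN : p + 3 ≤ N)
    {t : V} (ht : t ∈ O) (v : V) :
    dq inc q (p + 2) v t ∘L inc p (p + 2) = inc (p + 1) (p + 3) ∘L dq inc q p v t := by
  have e1 := fderiv_eq_comp_op_right h.isOpen (F := fun t => inc (p + 2) (p + 3) ∘L q (p + 2) t)
    (G := fun t => (inc (p + 2) (p + 3) ∘L q (p + 2) t) ∘L inc p (p + 2)) (A := inc p (p + 2))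
    (fun s hs => rfl) ht
    (h.hasFDerivAt_q (p := p + 2) (by grind) (by omega) ht).differentiableAt v
  have e2 := fderiv_eq_comp_op_left h.isOpen (F := fun t => inc p (p + 1) ∘L q p t)
    (G := fun t => (inc (p + 2) (p + 3) ∘L q (p + 2) t) ∘L inc p (p + 2))
    (A := inc (p + 1) (p + 3)) (fun s hs => by
      rw [ContinuousLinearMap.comp_assoc, h.q_inc p (p + 2) (by omega) (by omega) s hs,
        ← ContinuousLinearMap.comp_assoc, ← ContinuousLinearMap.comp_assoc,
        h.inc_comp p (p + 2) (p + 3) (by omega) (by omega) (by omega),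
        h.inc_comp p (p + 1) (p + 3) (by omega) (by omega) (by omega)]) ht
    (h.hasFDerivAt_q hp (by omega) ht).differentiableAt v
  exact e1.symm.trans e2

/-- The resolvent identity is routed as `S i → S (i+1) → S (i+2) → S k`. The middle factor `Q(s) -
Q(t)` starts at an odd index, hence is differentiable, and it vanishes at `s = t`. So continuity of
the left resolvent suffices, and this is what the third space pays for. -/
theorem hasFDerivAt_r (h : ResolventScale N O inc q r) {i k : ℕ} (hi : Even i) (hik : i + 3 ≤ k)
    (hkN : k ≤ N) {t : V} (ht : t ∈ O) :
    HasFDerivAt (fun t => inc i k ∘L r i t)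
      ((compLeftReal (inc (i + 2) k ∘L r (i + 2) t)).comp
        ((compRightReal (inc i (i + 1) ∘L r i t)).comp
          (fderiv ℝ (fun t => inc (i + 1) (i + 2) ∘L q (i + 1) t) t))) t := by
  have hc : ContinuousAt (fun s => inc (i + 2) k ∘L r (i + 2) s) t := by
    have h1 := (h.continuousOn_r (i := i + 2) (by grind) (by omega)).continuousAt
      (h.isOpen.mem_nhds ht)
    have h2 := (compLeftReal (X := S (i + 2)) (inc (i + 3) k)).continuous.continuousAt.comp h1
    refine h2.congr (Eventually.of_forall fun s => ?_)
    simp only [Function.comp, compLeftReal_apply]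
    rw [← ContinuousLinearMap.comp_assoc, h.inc_comp (i + 2) (i + 2 + 1) k (by omega) hik hkN]
  have hw : HasFDerivAt (fun s => (inc (i + 1) (i + 2) ∘L q (i + 1) s
      - inc (i + 1) (i + 2) ∘L q (i + 1) t) ∘L (inc i (i + 1) ∘L r i t)) _ t :=
    ((h.hasFDerivAt_q (p := i + 1) (by grind) (by omega) ht).sub_const _).comp_op_right _
  have h1 := HasFDerivAt.continuousAt_comp_of_eq_zero hc hw (by simp)
  refine (h1.add_const (inc i k ∘L r i t)).congr_of_eventuallyEq ?_
  filter_upwards [h.isOpen.mem_nhds ht] with s hs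
  have e1 : ∀ x, inc i k x = inc (i + 2) k (inc i (i + 2) x) := fun x =>
    (DFunLike.congr_fun (h.inc_comp i (i + 2) k (by omega) (by omega) hkN) x).symm
  have e2 : ∀ x, inc i (i + 2) x = inc (i + 1) (i + 2) (inc i (i + 1) x) := fun x =>
    (DFunLike.congr_fun (h.inc_comp i (i + 1) (i + 2) (by omega) (by omega) (by omega)) x).symm
  have e3 : ∀ s ∈ O, ∀ x, inc i (i + 1) (q i s x) = q (i + 1) s (inc i (i + 1) x) :=
    fun s hs x => (DFunLike.congr_fun (h.q_inc i (i + 1) (by omega) (by omega) s hs) x).symm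
  have e4 : ∀ x, inc i (i + 2) (r i s x) = r (i + 2) s (inc i (i + 2) x) :=
    fun x => (DFunLike.congr_fun (h.r_inc i (i + 2) (by omega) (by omega) s hs) x).symm
  rw [← sub_eq_iff_eq_add, ← ContinuousLinearMap.comp_sub, h.resolvent_eq i (by omega) s hs t ht]
  ext x
  simp only [ContinuousLinearMap.comp_apply, sub_apply, e1, e4]
  simp only [e2, e3 s hs, e3 t ht, map_sub]

/-- Resolvents lose `2 l + 1` spaces of the scale for `l` derivatives. -/
theorem contDiffOn_r [FiniteDimensional ℝ V] (h : ResolventScale N O inc q r) (l : ℕ) : ∀ i k, Even i →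
    k = i + 2 * l + 1 → k ≤ N → ContDiffOn ℝ l (fun t => inc i k ∘L r i t) O := by
  induction l using Nat.strong_induction_on with
  | _ l ih =>
  intro i k hi hk hkN
  rcases l with _ | l
  · subst hk
    simpa using h.continuousOn_r hi hkN
  refine contDiffOn_succ_of_hasFDerivAt h.isOpen
    (fun t ht => h.hasFDerivAt_r hi (by omega) hkN ht) fun v => ?_
  -- The left pair in `R Q' R`. The grading is by the spaces `S (p + 1 + 2 l)`: `Q'` is `C^l` into
  -- them, and by the induction hypothesis `R` is `C^(n' - l)` out of them.
  have inner : ∀ p n', Odd p → k = p + 2 + 2 * n' → n' ≤ l →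
      ContDiffOn ℝ n' (fun t => (inc (p + 1) k ∘L r (p + 1) t) ∘L dq inc q p v t) O := by
    intro p n' hp hk' hn'
    have := contDiffOn_comp_of_graded h.isOpen n' (Y := fun l => S (p + 1 + 2 * l))
      (fun l => inc (p + 1 + 2 * l) (p + 1 + 2 * (l + 1)))
      (fun l t => inc (p + 1) (p + 1 + 2 * l) ∘L dq inc q p v t)
      (fun l t => inc (p + 1 + 2 * l) k ∘L r (p + 1 + 2 * l) t)
      (fun l hl => h.contDiffOn_dq hp l _ rfl (by omega) v)
      (fun l hl => ih (n' - l) (by omega) _ _ (by grind) (by omega) hkN)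
      (fun l hl t ht => by
        rw [← ContinuousLinearMap.comp_assoc, h.inc_comp _ _ _ (by omega) (by omega) (by omega)])
      (fun l hl t ht => by
        rw [ContinuousLinearMap.comp_assoc, h.r_inc _ _ (by omega) (by omega) t ht,
          ← ContinuousLinearMap.comp_assoc, h.inc_comp _ _ _ (by omega) (by omega) hkN])
    refine this.congr fun t ht => ?_
    simp [h.inc_self (p + 1) (by omega)]
  -- The full product `(R Q') R`, graded by the odd spaces `S (i + 1 + 2 l)`: the right resolvent
  -- gains its order on the way in, and `inner` supplies the rest on the way out.
  have := contDiffOn_comp_of_graded h.isOpen l (Y := fun l => S (i + 1 + 2 * l))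
    (fun l => inc (i + 1 + 2 * l) (i + 1 + 2 * (l + 1)))
    (fun l t => inc i (i + 1 + 2 * l) ∘L r i t)
    (fun l t => (inc (i + 1 + 2 * l + 1) k ∘L r (i + 1 + 2 * l + 1) t) ∘L
      dq inc q (i + 1 + 2 * l) v t)
    (fun l hl => ih l (by omega) _ _ hi (by omega) (by omega))
    (fun n hn => inner (i + 1 + 2 * n) (l - n) (by grind) (by omega) (by omega))
    (fun l hl t ht => by
      rw [← ContinuousLinearMap.comp_assoc, h.inc_comp _ _ _ (by omega) (by omega) (by omega)])
    (fun n hn t ht => by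
      have e := h.dq_inc (p := i + 1 + 2 * n) (by grind) (by omega) ht v
      have e2 := h.r_inc (i + 1 + 2 * n + 1) (i + 1 + 2 * n + 3) (by omega) (by omega) t ht
      have e3 := h.inc_comp (i + 1 + 2 * n + 1) (i + 1 + 2 * n + 3) k (by omega) (by omega) hkN
      rw [← e3, ContinuousLinearMap.comp_assoc (inc (i + 1 + 2 * n + 3) k), ← e2,
        ContinuousLinearMap.comp_assoc (inc (i + 1 + 2 * n + 3) k),
        ContinuousLinearMap.comp_assoc (r (i + 1 + 2 * n + 3) t), ← e]
      rfl)
  exact this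

end ResolventScale

end ResolventScale

/-! ### The Keller–Liverani perturbation theorem -/

section KellerLiverani

variable {X : Type*} [NormedAddCommGroup X] [NormedSpace ℂ X]

theorem resolventDomain_ne_zero {κ : ℝ} (hκ : 0 < κ) {z : ℂ} (hz : z ∈ resolventDomain κ) :
    z ≠ 0 := norm_pos_iff.1 (hκ.trans_le hz.1)

theorem resolvent_apply_sub {T : X →L[ℂ] X} {z : ℂ} (hz : z ∈ resolventSet ℂ T) (f : X) :
    resolvent T z (z • f - T f) = f := by
  have h : resolvent T z * (algebraMap ℂ (X →L[ℂ] X) z - T) = 1 :=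
    Ring.inverse_mul_cancel _ hz
  have := DFunLike.congr_fun h f
  simpa [Algebra.algebraMap_eq_smul_one] using this

theorem smul_resolvent_apply_sub {T : X →L[ℂ] X} {z : ℂ} (hz : z ∈ resolventSet ℂ T) (f : X) :
    z • resolvent T z f - T (resolvent T z f) = f := by
  have h : (algebraMap ℂ (X →L[ℂ] X) z - T) * resolvent T z = 1 :=
    Ring.mul_inverse_cancel _ hz
  have := DFunLike.congr_fun h f
  simpa [Algebra.algebraMap_eq_smul_one] using this

theorem commute_resolvent {T : X →L[ℂ] X} {z : ℂ} (hz : z ∈ resolventSet ℂ T) :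
    Commute T (resolvent T z) := by
  ext f
  have h1 := smul_resolvent_apply_sub hz f
  have h2 := resolvent_apply_sub hz f
  rw [map_sub, map_smul] at h2
  simp only [mul_apply_eq_comp]
  have := h1.trans h2.symm
  exact sub_right_injective this

theorem norm_resolvent_le {T : X →L[ℂ] X} {z : ℂ} (hz : z ∈ resolventSet ℂ T) {K : ℝ}
    (hK0 : 0 ≤ K) (hK : ∀ f, ‖f‖ ≤ K * ‖z • f - T f‖) : ‖resolvent T z‖ ≤ K := by
  refine ContinuousLinearMap.opNorm_le_bound _ hK0 fun f => ?_
  simpa [smul_resolvent_apply_sub hz f] using hK (resolvent T z f)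

theorem mem_resolventSet_of_near [CompleteSpace X] {T : X →L[ℂ] X} {w z : ℂ}
    (hw : w ∈ resolventSet ℂ T) (h : ‖w - z‖ * ‖resolvent T w‖ < 1) : z ∈ resolventSet ℂ T := by
  have h1 : IsUnit (1 - (w - z) • resolvent T w) := by
    apply isUnit_one_sub_of_norm_lt_one
    rwa [norm_smul]
  have h2 : (algebraMap ℂ (X →L[ℂ] X) w - T) * resolvent T w = 1 :=
    Ring.mul_inverse_cancel _ hw
  have : algebraMap ℂ (X →L[ℂ] X) z - T
      = (algebraMap ℂ (X →L[ℂ] X) w - T) * (1 - (w - z) • resolvent T w) := by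
    rw [mul_sub, mul_one, mul_smul_comm, h2]
    simp only [Algebra.algebraMap_eq_smul_one, sub_smul]
    abel
  rw [spectrum.mem_resolventSet_iff, this]
  exact IsUnit.mul hw h1

/-- A uniform lower bound on the operators `z - T`, for `z ∈ 𝒟_κ`, makes them invertible. -/
theorem resolventDomain_subset_resolventSet [CompleteSpace X] {T : X →L[ℂ] X} {κ K : ℝ}
    (hK0 : 0 < K) (hK : ∀ z ∈ resolventDomain κ, ∀ f, ‖f‖ ≤ K * ‖z • f - T f‖) {z : ℂ}
    (hz : z ∈ resolventDomain κ) : z ∈ resolventSet ℂ T := by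
  -- Lower bounds alone do not give surjectivity. Invertibility is carried from far away, where it
  -- is automatic, back to `z` along the vertical ray leaving the real axis (`σ` is the sign of `Im
  -- z`). On this ray the distances to `0` and `1` do not decrease, so it stays in `𝒟_κ`; the step
  -- `c = 1/(2K)` is within the Neumann radius because resolvents met on the way have norm at most
  -- `K`.
  obtain ⟨σ, hσ, hσz⟩ : ∃ σ : ℝ, |σ| = 1 ∧ 0 ≤ σ * z.im := by
    rcases le_total 0 z.im with h | h
    · exact ⟨1, by simp, by simpa using h⟩
    · exact ⟨-1, by simp, by simpa using h⟩
  have hσ2 : σ * σ = 1 := by rw [← abs_mul_abs_self, hσ, one_mul]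
  set c : ℝ := (2 * K)⁻¹
  have hc : 0 < c := by positivity
  have up : ∀ (w : ℂ) (a : ℝ), 0 ≤ σ * w.im → ‖w - a‖ ≤ ‖w + (c * σ : ℝ) * Complex.I - a‖ := by
    intro w a hw
    rw [← sq_le_sq₀ (norm_nonneg _) (norm_nonneg _), ← Complex.normSq_eq_norm_sq,
      ← Complex.normSq_eq_norm_sq, Complex.normSq_apply, Complex.normSq_apply]
    simp
    nlinarith [mul_nonneg hc.le hw, mul_nonneg hc.le hc.le]
  obtain ⟨n, hn⟩ := exists_nat_gt (‖T‖ * ‖(1 : X →L[ℂ] X)‖ / c)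
  have main : ∀ n : ℕ, ∀ w ∈ resolventDomain κ, 0 ≤ σ * w.im →
      ‖T‖ * ‖(1 : X →L[ℂ] X)‖ < |w.im| + n * c → w ∈ resolventSet ℂ T := by
    intro n
    induction n with
    | zero =>
      intro w _ _ h
      refine spectrum.mem_resolventSet_of_norm_lt_mul (h.trans_le ?_)
      simpa using Complex.abs_im_le_norm w
    | succ n ih =>
      intro w hw hwσ h
      set w' : ℂ := w + (c * σ : ℝ) * Complex.I
      have him : w'.im = w.im + c * σ := by simp [w']
      have hw' : w' ∈ resolventDomain κ :=
        ⟨hw.1.trans (by simpa [w'] using up w 0 hwσ), hw.2.trans (by simpa [w'] using up w 1 hwσ)⟩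
      have hσ' : σ * w'.im = σ * w.im + c := by rw [him, mul_add, mul_left_comm, hσ2, mul_one]
      have habs : |w'.im| = |w.im| + c := by
        have e1 : |w'.im| = |σ * w'.im| := by rw [abs_mul, hσ, one_mul]
        have e2 : |w.im| = |σ * w.im| := by rw [abs_mul, hσ, one_mul]
        rw [e1, e2, abs_of_nonneg hwσ, hσ', abs_of_nonneg (by positivity)]
      have hmem := ih w' hw' (by rw [hσ']; positivity)
        (by rw [habs]; push_cast at h; linarith)
      refine mem_resolventSet_of_near hmem ?_
      have h1 : ‖w' - w‖ = c := by
        simp [w', abs_of_pos hc, hσ]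
      rw [h1]
      calc c * ‖resolvent T w'‖ ≤ c * K := by
            gcongr
            exact norm_resolvent_le hmem hK0.le (hK w' hw')
        _ < 1 := by simp only [c]; field_simp; norm_num
  refine main n z hz hσz ?_
  rw [div_lt_iff₀ hc] at hn
  linarith [abs_nonneg z.im]

/-- The expansion of `f` along the iterates of `T`, with the remainder `(z - T) f`. -/
theorem eq_iterate_add_sum {T : X →L[ℂ] X} {z : ℂ} (hz : z ≠ 0) (f : X) (n : ℕ) :
    f = z⁻¹ ^ n • (T ^ n) f +
      ∑ k ∈ Finset.range n, z⁻¹ ^ (k + 1) • (T ^ k) (z • f - T f) := by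
  induction n with
  | zero => simp
  | succ n ih =>
    rw [Finset.sum_range_succ]
    have : z⁻¹ ^ n • (T ^ n) f = z⁻¹ ^ (n + 1) • (T ^ (n + 1)) f
        + z⁻¹ ^ (n + 1) • (T ^ n) (z • f - T f) := by
      rw [map_sub, map_smul, smul_sub, smul_smul, pow_succ T, mul_apply_eq_comp,
        pow_succ, mul_assoc, inv_mul_cancel₀ hz, mul_one]
      abel
    rw [this] at ih
    nth_rewrite 1 [ih]
    abel

/-- A Doeblin–Fortet inequality for the iterates of `T`, which contracts the seminorm `p`. -/
structure DoeblinFortet (p : Seminorm ℂ X) (κ₁ C : ℝ) (T : X →L[ℂ] X) : Prop where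
  contract : ∀ f, p (T f) ≤ p f
  pow_le : ∀ n : ℕ, 1 ≤ n → ∀ f, ‖(T ^ n) f‖ ≤ C * κ₁ ^ n * ‖f‖ + C * p f

namespace DoeblinFortet

variable {p : Seminorm ℂ X} {κ₁ C A : ℝ} {T : X →L[ℂ] X}

theorem contract_pow (h : DoeblinFortet p κ₁ C T) (n : ℕ) (f : X) : p ((T ^ n) f) ≤ p f := by
  induction n with
  | zero => simp
  | succ n ih =>
    rw [pow_succ', mul_apply_eq_comp]
    exact (h.contract _).trans ih

theorem norm_pow_le (h : DoeblinFortet p κ₁ C T) (hκ₁ : 0 ≤ κ₁) (hκ₁' : κ₁ ≤ 1) (hC : 0 ≤ C)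
    (hp : ∀ f, p f ≤ A * ‖f‖) (n : ℕ) (f : X) :
    ‖(T ^ n) f‖ ≤ (1 + C + C * A) * ‖f‖ := by
  have hA : 0 ≤ A * ‖f‖ := (apply_nonneg p f).trans (hp f)
  rcases Nat.eq_zero_or_pos n with rfl | hn
  · simp only [pow_zero, one_apply_eq_self]
    nlinarith [mul_nonneg hC (norm_nonneg f), mul_nonneg hC hA]
  · refine (h.pow_le n hn f).trans ?_
    have h1 : C * κ₁ ^ n * ‖f‖ ≤ C * 1 * ‖f‖ := by
      gcongr
      exact pow_le_one₀ hκ₁ hκ₁'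
    nlinarith [mul_le_mul_of_nonneg_left (hp f) hC, norm_nonneg f]

end DoeblinFortet

theorem exists_geom_le {κ₁ κ : ℝ} (hκ₁ : 0 ≤ κ₁) (hκ : κ₁ < κ) (C : ℝ) {ε : ℝ} (hε : 0 < ε) :
    ∃ n : ℕ, 1 ≤ n ∧ C * (κ₁ / κ) ^ n ≤ ε := by
  have h : Tendsto (fun n : ℕ => C * (κ₁ / κ) ^ n) atTop (𝓝 0) := by
    have h0 : 0 < κ := hκ₁.trans_lt hκ
    simpa using (tendsto_pow_atTop_nhds_zero_of_lt_one (div_nonneg hκ₁ h0.le)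
      ((div_lt_one h0).2 hκ)).const_mul C
  obtain ⟨n, h1, h2⟩ := ((h.eventually_le_const hε).and (eventually_ge_atTop 1)).exists
  exact ⟨n, h2, h1⟩

variable {p : Seminorm ℂ X} {κ₁ C A κ : ℝ}

/-- Lower bound on `z - T` modulo the seminorm `p`. -/
theorem exists_lower_bound_mod_seminorm (hκ₁ : 0 ≤ κ₁) (hκ₁' : κ₁ ≤ 1) (hC : 0 ≤ C) (hA : 0 ≤ A)
    (hp : ∀ f, p f ≤ A * ‖f‖) (hκ : κ₁ < κ) :
    ∃ K : ℝ, 0 < K ∧ ∀ T : X →L[ℂ] X, DoeblinFortet p κ₁ C T → ∀ z : ℂ, κ ≤ ‖z‖ → ∀ f,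
      ‖f‖ ≤ K * (‖z • f - T f‖ + p f) := by
  have h0 : 0 < κ := hκ₁.trans_lt hκ
  -- The strong term `C (κ₁/κ)ⁿ ‖f‖` becomes at most `‖f‖/2` and is absorbed. As `n` depends only on
  -- the constants, `K` is uniform in `T` and `z`.
  obtain ⟨n, hn1, hn⟩ := exists_geom_le hκ₁ hκ C (half_pos one_pos)
  set S : ℝ := ∑ k ∈ Finset.range n, κ⁻¹ ^ (k + 1) * (1 + C + C * A)
  have hS : 0 ≤ S := Finset.sum_nonneg fun k _ => by positivity
  refine ⟨2 * (S + κ⁻¹ ^ n * C + 1), by positivity, fun T hT z hz f => ?_⟩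
  have hz0 : z ≠ 0 := norm_pos_iff.1 (h0.trans_le hz)
  have hzi : ‖z⁻¹‖ ≤ κ⁻¹ := by rw [norm_inv]; gcongr
  have e := eq_iterate_add_sum (T := T) hz0 f n
  set g := z • f - T f
  have h1 : ‖z⁻¹ ^ n • (T ^ n) f‖ ≤ 1 / 2 * ‖f‖ + κ⁻¹ ^ n * C * p f := by
    rw [norm_smul, norm_pow]
    calc ‖z⁻¹‖ ^ n * ‖(T ^ n) f‖ ≤ κ⁻¹ ^ n * (C * κ₁ ^ n * ‖f‖ + C * p f) := by
          gcongr
          exact hT.pow_le n hn1 f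
      _ = C * (κ₁ / κ) ^ n * ‖f‖ + κ⁻¹ ^ n * C * p f := by
          rw [div_eq_mul_inv, mul_pow]; ring
      _ ≤ _ := by gcongr
  have h2 : ‖∑ k ∈ Finset.range n, z⁻¹ ^ (k + 1) • (T ^ k) g‖ ≤ S * ‖g‖ := by
    rw [Finset.sum_mul]
    refine norm_sum_le_of_le _ fun k _ => ?_
    rw [norm_smul, norm_pow, mul_assoc]
    gcongr
    exact hT.norm_pow_le hκ₁ hκ₁' hC hp k g
  have h3 : ‖f‖ ≤ 1 / 2 * ‖f‖ + κ⁻¹ ^ n * C * p f + S * ‖g‖ := by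
    calc ‖f‖ = _ := congrArg norm e
      _ ≤ _ := norm_add_le_of_le h1 h2
  have hpf := apply_nonneg p f
  have h4 : 0 ≤ κ⁻¹ ^ n * C := by positivity
  nlinarith [mul_nonneg hS hpf, mul_nonneg h4 (norm_nonneg g), norm_nonneg g]

/-- The seminorm of `R_z h` is controlled by the seminorm of `h`, up to a small multiple of the
norm. -/
theorem exists_seminorm_resolvent_le (hκ₁ : 0 ≤ κ₁) (hC : 0 ≤ C) (hA : 0 ≤ A)
    (hp : ∀ f, p f ≤ A * ‖f‖) (hκ : κ₁ < κ) {M : ℝ} (hM : 0 ≤ M) {ε : ℝ} (hε : 0 < ε) :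
    ∃ K : ℝ, 0 < K ∧ ∀ T : X →L[ℂ] X, DoeblinFortet p κ₁ C T → ∀ z ∈ resolventSet ℂ T, κ ≤ ‖z‖ →
      ‖resolvent T z‖ ≤ M → ∀ h, p (resolvent T z h) ≤ ε * ‖h‖ + K * p h := by
  have h0 : 0 < κ := hκ₁.trans_lt hκ
  obtain ⟨n, hn1, hn⟩ := exists_geom_le hκ₁ hκ (A * M * C) hε
  set S : ℝ := ∑ k ∈ Finset.range n, κ⁻¹ ^ (k + 1)
  have hS : 0 ≤ S := Finset.sum_nonneg fun k _ => by positivity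
  refine ⟨S + κ⁻¹ ^ n * (A * M * C) + 1, by positivity, fun T hT z hzr hz hRM h => ?_⟩
  have hz0 : z ≠ 0 := norm_pos_iff.1 (h0.trans_le hz)
  have hzi : ‖z⁻¹‖ ≤ κ⁻¹ := by rw [norm_inv]; gcongr
  set f := resolvent T z h with hf
  have e := eq_iterate_add_sum (T := T) hz0 f n
  rw [hf, smul_resolvent_apply_sub hzr h, ← hf] at e
  -- Commuting `Tⁿ` past the resolvent lets the Doeblin–Fortet inequality act on `h` rather than on
  -- `f`; the crude factor `A M` was anticipated in the choice of `n`.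
  have hcomm : (T ^ n) f = resolvent T z ((T ^ n) h) :=
    DFunLike.congr_fun ((commute_resolvent hzr).pow_left n).eq h
  have h1 : p (z⁻¹ ^ n • (T ^ n) f) ≤ ε * ‖h‖ + κ⁻¹ ^ n * (A * M * C) * p h := by
    rw [map_smul_eq_mul, norm_pow]
    calc ‖z⁻¹‖ ^ n * p ((T ^ n) f) ≤ κ⁻¹ ^ n * (A * (M * (C * κ₁ ^ n * ‖h‖ + C * p h))) := by
          gcongr
          refine (hp _).trans ?_
          gcongr
          rw [hcomm]
          refine (ContinuousLinearMap.le_opNorm _ _).trans ?_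
          gcongr
          exact hT.pow_le n hn1 h
      _ = A * M * C * (κ₁ / κ) ^ n * ‖h‖ + κ⁻¹ ^ n * (A * M * C) * p h := by
          rw [div_eq_mul_inv, mul_pow]; ring
      _ ≤ _ := by gcongr
  have h2 : p (∑ k ∈ Finset.range n, z⁻¹ ^ (k + 1) • (T ^ k) h) ≤ S * p h := by
    rw [Finset.sum_mul]
    refine (Finset.le_sum_of_subadditive p (map_zero p).le (map_add_le_add p) _ _).trans (Finset.sum_le_sum fun k _ => ?_)
    rw [map_smul_eq_mul, norm_pow]
    gcongr
    exact hT.contract_pow k h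
  have h3 : p f ≤ _ := (congrArg p e).le.trans ((map_add_le_add p _ _).trans (add_le_add h1 h2))
  linarith [apply_nonneg p h]

theorem mul_eq_of_tendsto_pow {T P : X →L[ℂ] X}
    (hT : Tendsto (fun n : ℕ => ‖T ^ n - P‖) atTop (𝓝 0)) : P * T = P := by
  have hT' := tendsto_iff_norm_sub_tendsto_zero.2 hT
  have h1 : Tendsto (fun n : ℕ => T ^ n * T) atTop (𝓝 (P * T)) := hT'.mul_const T
  have h2 : Tendsto (fun n : ℕ => T ^ (n + 1)) atTop (𝓝 P) := hT'.comp (tendsto_add_atTop_nat 1)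
  exact tendsto_nhds_unique h1 (by simpa only [pow_succ] using h2)

/-- If `T ^ n → P`, the resolvent of `T` is bounded on `𝒟_κ` for `κ` close to `1`. -/
theorem exists_lower_bound_of_tendsto {T P : X →L[ℂ] X}
    (hT : Tendsto (fun n : ℕ => ‖T ^ n - P‖) atTop (𝓝 0)) :
    ∃ κ₀ < 1, ∀ κ : ℝ, κ₀ < κ → 0 < κ → κ < 1 →
      (∃ n : ℕ, 1 ≤ n ∧ ‖T ^ n - P‖ < κ ^ n) ∧ ∃ K : ℝ, 0 < K ∧ ∀ z ∈ resolventDomain κ,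
        ∀ f, ‖f‖ ≤ K * ‖z • f - T f‖ := by
  have hPT := mul_eq_of_tendsto_pow hT
  obtain ⟨n, hn1, hn⟩ : ∃ n : ℕ, 1 ≤ n ∧ ‖T ^ n - P‖ ≤ 1 / 2 := by
    obtain ⟨n, h1, h2⟩ := ((hT.eventually_le_const (half_pos one_pos)).and
      (eventually_ge_atTop 1)).exists
    exact ⟨n, h2, h1⟩
  -- Bernoulli's inequality with `κ₀ = 1 - 1/(3n)`. Then `κ⁻ⁿ ‖Tⁿ - P‖ ≤ 3/4`, which leaves a
  -- quarter of `‖f‖` to absorb into.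
  obtain ⟨κ₀, hκ₀, hκ₀'⟩ : ∃ κ₀ < 1, ∀ κ : ℝ, κ₀ < κ → 2 / 3 < κ ^ n := by
    have hn' : (0 : ℝ) < n := by exact_mod_cast hn1
    refine ⟨1 - 1 / (3 * n), by linarith [show 0 < 1 / (3 * (n : ℝ)) by positivity],
      fun κ hκ => ?_⟩
    have h1 : 1 / (3 * (n : ℝ)) ≤ 1 / 3 := by
      rw [div_le_div_iff₀ (by positivity) (by norm_num)]
      have : (1 : ℝ) ≤ n := by exact_mod_cast hn1
      linarith
    have h2 := one_add_mul_le_pow (a := κ - 1) (by linarith) n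
    have h3 : (n : ℝ) * (1 / (3 * n)) = 1 / 3 := by field_simp
    rw [add_sub_cancel] at h2
    nlinarith [mul_lt_mul_of_pos_left hκ hn']
  refine ⟨κ₀, hκ₀, fun κ hκ h0 h1 => ?_⟩
  set S : ℝ := ∑ k ∈ Finset.range n, κ⁻¹ ^ (k + 1) * ‖T ^ k‖
  have hS : 0 ≤ S := Finset.sum_nonneg fun k _ => by positivity
  set B : ℝ := κ⁻¹ ^ n * (‖P‖ * ((1 - κ) / 2)⁻¹)
  have hκ1 : 0 < (1 - κ) / 2 := by linarith
  have hB : 0 ≤ B := by positivity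
  refine ⟨⟨n, hn1, by linarith [hκ₀' κ hκ]⟩, 4 * (B + S) + 1, by positivity, fun z hz f => ?_⟩
  have hz0 : z ≠ 0 := resolventDomain_ne_zero h0 hz
  have hzi : ‖z⁻¹‖ ≤ κ⁻¹ := by rw [norm_inv]; gcongr; exact hz.1
  have e := eq_iterate_add_sum (T := T) hz0 f n
  -- This is where `|z - 1| ≥ (1 - κ)/2` enters: it bounds `P f` by `g = (z - T) f`.
  have hPg : P (z • f - T f) = (z - 1) • P f := by
    rw [map_sub, map_smul, sub_smul, one_smul]
    congr 1
    exact DFunLike.congr_fun hPT f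
  set g := z • f - T f
  have hPf : ‖P f‖ ≤ ‖P‖ * ((1 - κ) / 2)⁻¹ * ‖g‖ := by
    have h2 : (1 - κ) / 2 * ‖P f‖ ≤ ‖P‖ * ‖g‖ := by
      calc (1 - κ) / 2 * ‖P f‖ ≤ ‖z - 1‖ * ‖P f‖ := by gcongr; exact hz.2
        _ = ‖P g‖ := by rw [hPg, norm_smul]
        _ ≤ _ := P.le_opNorm g
    rw [mul_right_comm, ← div_eq_mul_inv, le_div_iff₀ hκ1]
    linarith
  have h2 : ‖z⁻¹ ^ n • (T ^ n) f‖ ≤ 3 / 4 * ‖f‖ + B * ‖g‖ := by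
    have h3 : ‖(T ^ n) f‖ ≤ 1 / 2 * ‖f‖ + ‖P‖ * ((1 - κ) / 2)⁻¹ * ‖g‖ := by
      calc ‖(T ^ n) f‖ = ‖(T ^ n - P) f + P f‖ := by simp
        _ ≤ _ := norm_add_le_of_le (((T ^ n - P).le_opNorm f).trans (by gcongr)) hPf
    have h4 : κ⁻¹ ^ n * (1 / 2) ≤ 3 / 4 := by
      rw [inv_pow, inv_mul_le_iff₀ (by positivity)]
      linarith [hκ₀' κ hκ]
    rw [norm_smul, norm_pow]
    calc ‖z⁻¹‖ ^ n * ‖(T ^ n) f‖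
        ≤ κ⁻¹ ^ n * (1 / 2 * ‖f‖ + ‖P‖ * ((1 - κ) / 2)⁻¹ * ‖g‖) := by gcongr
      _ = κ⁻¹ ^ n * (1 / 2) * ‖f‖ + B * ‖g‖ := by simp only [B]; ring
      _ ≤ _ := by gcongr
  have h5 : ‖∑ k ∈ Finset.range n, z⁻¹ ^ (k + 1) • (T ^ k) g‖ ≤ S * ‖g‖ := by
    rw [Finset.sum_mul]
    refine norm_sum_le_of_le _ fun k _ => ?_
    rw [norm_smul, norm_pow, mul_assoc]
    gcongr
    exact (T ^ k).le_opNorm g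
  have h6 : ‖f‖ ≤ 3 / 4 * ‖f‖ + B * ‖g‖ + S * ‖g‖ := by
    calc ‖f‖ = _ := congrArg norm e
      _ ≤ _ := norm_add_le_of_le h2 h5
  nlinarith [norm_nonneg g]

/-- The **Keller–Liverani theorem**: the resolvents of small perturbations `T t` of `T₀`, in the
weak sense of the seminorm `p`, are uniformly bounded on `𝒟_κ`, and converge weakly. -/
theorem keller_liverani [CompleteSpace X] {ι : Type*} {l : Filter ι} {T : ι → X →L[ℂ] X}
    {T₀ P : X →L[ℂ] X} (hκ₁ : 0 ≤ κ₁) (hκ₁' : κ₁ < 1) (hC : 0 ≤ C) (hA : 0 ≤ A)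
    (hp : ∀ f, p f ≤ A * ‖f‖) (hT₀ : DoeblinFortet p κ₁ C T₀)
    (hT : ∀ᶠ t in l, DoeblinFortet p κ₁ C (T t))
    (hP : Tendsto (fun n : ℕ => ‖T₀ ^ n - P‖) atTop (𝓝 0))
    (hcont : ∀ ε > 0, ∀ᶠ t in l, ∀ f, p (T t f - T₀ f) ≤ ε * ‖f‖) :
    ∃ κ₀ < 1, κ₁ ≤ κ₀ ∧ ∀ κ : ℝ, κ₀ < κ → κ < 1 →
      (∃ n : ℕ, 1 ≤ n ∧ ‖T₀ ^ n - P‖ < κ ^ n) ∧ ∃ M : ℝ, 0 < M ∧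
      (∀ z ∈ resolventDomain κ, z ∈ resolventSet ℂ T₀ ∧ ‖resolvent T₀ z‖ ≤ M) ∧
      (∀ᶠ t in l, ∀ z ∈ resolventDomain κ, z ∈ resolventSet ℂ (T t) ∧ ‖resolvent (T t) z‖ ≤ M) ∧
      ∀ δ > 0, ∀ᶠ t in l, ∀ z ∈ resolventDomain κ, ∀ f,
        p (resolvent (T t) z f - resolvent T₀ z f) ≤ δ * ‖f‖ := by
  obtain ⟨κ₀, hκ₀, hκ₀'⟩ := exists_lower_bound_of_tendsto hP
  refine ⟨max κ₁ κ₀, max_lt hκ₁' hκ₀, le_max_left _ _, fun κ hκ hκ1 => ?_⟩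
  rw [max_lt_iff] at hκ
  have h0 : 0 < κ := hκ₁.trans_lt hκ.1
  obtain ⟨hrate, M₀, hM₀, hlow⟩ := hκ₀' κ hκ.2 h0 hκ1
  have hres₀ : ∀ z ∈ resolventDomain κ, z ∈ resolventSet ℂ T₀ := fun z hz =>
    resolventDomain_subset_resolventSet hM₀ hlow hz
  have hbd₀ : ∀ z ∈ resolventDomain κ, ‖resolvent T₀ z‖ ≤ M₀ := fun z hz =>
    norm_resolvent_le (hres₀ z hz) hM₀.le (hlow z hz)
  obtain ⟨K₁, hK₁, hlow₁⟩ := exists_lower_bound_mod_seminorm hκ₁ hκ₁'.le hC hA hp hκ.1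
  set H : ℝ := 1 + C + C * A
  have hH : 0 < H := by positivity
  have hnorm : ∀ S : X →L[ℂ] X, DoeblinFortet p κ₁ C S → ∀ f, ‖S f‖ ≤ H * ‖f‖ := fun S hS f => by
    simpa using hS.norm_pow_le hκ₁ hκ₁'.le hC hp 1 f
  -- With `ε = 1/(8 K₁ H)`, and later the weak closeness `1/(4 K₁ K)`, the strong and weak sizes of
  -- `T t - T₀` each cost `‖f‖/4` in `key`; absorbing their sum gives the factor `2` in `M`.
  obtain ⟨K, hK, hsem⟩ := exists_seminorm_resolvent_le hκ₁ hC hA hp hκ.1 hM₀.le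
    (ε := (8 * K₁ * H)⁻¹) (by positivity)
  set ε : ℝ := (8 * K₁ * H)⁻¹ with hε
  set M : ℝ := 2 * K₁ * (1 + ε + K * A)
  have hε0 : 0 < ε := by positivity
  have hM : 0 < M := by positivity
  have hdiff : ∀ t, DoeblinFortet p κ₁ C (T t) → ∀ f, ‖T t f - T₀ f‖ ≤ 2 * H * ‖f‖ :=
    fun t ht f => (norm_sub_le_of_le (hnorm _ ht f) (hnorm _ hT₀ f)).trans (by linarith)
  have hbd : ∀ᶠ t in l, ∀ z ∈ resolventDomain κ,
      z ∈ resolventSet ℂ (T t) ∧ ‖resolvent (T t) z‖ ≤ M := by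
    filter_upwards [hT, hcont (4 * K₁ * K)⁻¹ (by positivity)] with t ht hct
    -- `f` is `(z - T₀)⁻¹` applied to `(z - T t) f + (T t - T₀) f`. The seminorm of the result sees
    -- `T t - T₀` weakly, up to `ε` times its norm, so weak closeness is enough.
    have key : ∀ z ∈ resolventDomain κ, ∀ f, ‖f‖ ≤ M * ‖z • f - T t f‖ := by
      intro z hz f
      have h1 := hlow₁ (T t) ht z hz.1 f
      set g := z • f - T t f
      have e : z • f - T₀ f = g + (T t f - T₀ f) := by simp only [g]; abel
      have e2 := resolvent_apply_sub (hres₀ z hz) f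
      rw [e] at e2
      have h2 := hsem T₀ hT₀ z (hres₀ z hz) hz.1 (hbd₀ z hz) (g + (T t f - T₀ f))
      rw [e2] at h2
      have h3 : ‖g + (T t f - T₀ f)‖ ≤ ‖g‖ + 2 * H * ‖f‖ :=
        norm_add_le_of_le le_rfl (hdiff t ht f)
      have h4 : p (g + (T t f - T₀ f)) ≤ A * ‖g‖ + (4 * K₁ * K)⁻¹ * ‖f‖ :=
        (map_add_le_add p _ _).trans (add_le_add (hp g) (hct f))
      have h5 : p f ≤ ε * (‖g‖ + 2 * H * ‖f‖) + K * (A * ‖g‖ + (4 * K₁ * K)⁻¹ * ‖f‖) :=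
        h2.trans (by gcongr)
      have h6 : K₁ * (ε * (2 * H * ‖f‖)) = 1 / 4 * ‖f‖ := by
        rw [hε]; field_simp; ring
      have h7 : K₁ * (K * ((4 * K₁ * K)⁻¹ * ‖f‖)) = 1 / 4 * ‖f‖ := by
        field_simp
      have h8 := mul_le_mul_of_nonneg_left h5 hK₁.le
      simp only [M]
      linarith
    exact fun z hz => ⟨resolventDomain_subset_resolventSet hM key hz,
      norm_resolvent_le (resolventDomain_subset_resolventSet hM key hz) hM.le (key z hz)⟩
  refine ⟨hrate, max M M₀, by positivity, fun z hz => ⟨hres₀ z hz, (hbd₀ z hz).trans (le_max_right _ _)⟩,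
    hbd.mono fun t ht z hz => ⟨(ht z hz).1, (ht z hz).2.trans (le_max_left _ _)⟩, fun δ hδ => ?_⟩
  obtain ⟨K', hK', hsem'⟩ := exists_seminorm_resolvent_le hκ₁ hC hA hp hκ.1 hM₀.le
    (ε := δ * (4 * H * M)⁻¹) (by positivity)
  filter_upwards [hT, hbd, hcont (δ * (2 * K' * M)⁻¹) (by positivity)] with t ht hbt hct z hz f
  obtain ⟨hr, hrM⟩ := hbt z hz
  -- Second resolvent identity. The strong and weak sizes of `T t - T₀` will contribute `δ/2` each.
  have e : resolvent (T t) z f - resolvent T₀ z f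
      = resolvent T₀ z (T t (resolvent (T t) z f) - T₀ (resolvent (T t) z f)) := by
    have h1 := smul_resolvent_apply_sub hr f
    have h2 := resolvent_apply_sub (hres₀ z hz) (resolvent (T t) z f)
    nth_rewrite 1 [← h2]
    rw [← map_sub]
    congr 1
    nth_rewrite 3 [← h1]
    abel
  have hR : ‖resolvent (T t) z f‖ ≤ M * ‖f‖ :=
    (ContinuousLinearMap.le_opNorm _ _).trans (by gcongr)
  rw [e]
  refine (hsem' T₀ hT₀ z (hres₀ z hz) hz.1 (hbd₀ z hz) _).trans ?_
  calc δ * (4 * H * M)⁻¹ * ‖T t (resolvent (T t) z f) - T₀ (resolvent (T t) z f)‖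
        + K' * p (T t (resolvent (T t) z f) - T₀ (resolvent (T t) z f))
      ≤ δ * (4 * H * M)⁻¹ * (2 * H * (M * ‖f‖)) + K' * (δ * (2 * K' * M)⁻¹ * (M * ‖f‖)) := by
        gcongr
        · exact (hdiff t ht _).trans (by gcongr)
        · exact (hct _).trans (by gcongr)
    _ = δ * ‖f‖ := by field_simp; ring

end KellerLiverani

/-! ### Moments of the resolvent on a circle -/

section RieszMoment

theorem ContinuousLinearMap.circleIntegral_comp_comm {F G : Type*} [NormedAddCommGroup F]
    [NormedSpace ℂ F] [CompleteSpace F] [NormedAddCommGroup G] [NormedSpace ℂ G] [CompleteSpace G]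
    (L : F →L[ℂ] G) {f : ℂ → F} {c : ℂ} {R : ℝ} (hf : CircleIntegrable f c R) :
    ∮ z in C(c, R), L (f z) = L (∮ z in C(c, R), f z) := by
  rw [circleIntegral, circleIntegral, ← L.intervalIntegral_comp_comm hf.out]
  simp

variable {X : Type*} [NormedAddCommGroup X] [NormedSpace ℂ X]

/-- The `n`-th moment `(2πi)⁻¹ ∮ zⁿ (z - T)⁻¹ dz` of the resolvent, on the circle `|z| = r`. -/
def rieszMoment (r : ℝ) (T : X →L[ℂ] X) (n : ℤ) : X →L[ℂ] X :=
  (2 * Real.pi * Complex.I : ℂ)⁻¹ • ∮ z in C(0, r), z ^ n • resolvent T z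

theorem continuousOn_resolvent [CompleteSpace X] (T : X →L[ℂ] X) :
    ContinuousOn (resolvent T : ℂ → X →L[ℂ] X) (resolventSet ℂ T) := fun _ hz =>
  (spectrum.hasDerivAt_resolvent_const_left hz).continuousAt.continuousWithinAt

variable {r : ℝ} {T : X →L[ℂ] X}

theorem norm_rieszMoment_le (hr : 0 < r) {M : ℝ}
    (hM : ∀ z ∈ Metric.sphere (0 : ℂ) r, ‖resolvent T z‖ ≤ M) (n : ℤ) :
    ‖rieszMoment r T n‖ ≤ r * (r ^ n * M) := by
  refine circleIntegral.norm_two_pi_i_inv_smul_integral_le_of_norm_le_const hr.le fun z hz => ?_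
  rw [norm_smul, norm_zpow, mem_sphere_zero_iff_norm.1 hz]
  gcongr
  exact hM z hz

theorem resolvent_apply_of_eigenvector {z μ : ℂ} {f : X} (hz : z ∈ resolventSet ℂ T)
    (hf : T f = μ • f) (hzμ : z ≠ μ) : resolvent T z f = (z - μ)⁻¹ • f := by
  have h := resolvent_apply_sub hz f
  rw [hf, ← sub_smul, map_smul] at h
  rw [eq_inv_smul_iff₀ (sub_ne_zero.2 hzμ), h]

variable [CompleteSpace X]

theorem circleIntegrable_zpow_smul_resolvent (hr : 0 < r)
    (hT : Metric.sphere (0 : ℂ) r ⊆ resolventSet ℂ T) (n : ℤ) :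
    CircleIntegrable (fun z => z ^ n • resolvent T z) 0 r := by
  refine ContinuousOn.circleIntegrable hr.le (ContinuousOn.fun_smul ?_
    ((continuousOn_resolvent T).mono hT))
  exact fun z hz => (continuousAt_zpow₀ z n
    (Or.inl (Metric.ne_of_mem_sphere hz hr.ne'))).continuousWithinAt

theorem rieszMoment_apply (hr : 0 < r) (hT : Metric.sphere (0 : ℂ) r ⊆ resolventSet ℂ T) (n : ℤ)
    (f : X) : rieszMoment r T n f =
      (2 * Real.pi * Complex.I : ℂ)⁻¹ • ∮ z in C(0, r), z ^ n • resolvent T z f := by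
  have := (ContinuousLinearMap.apply ℂ X f).circleIntegral_comp_comm
    (circleIntegrable_zpow_smul_resolvent hr hT n)
  simp only [ContinuousLinearMap.apply_apply, smul_apply] at this
  rw [rieszMoment, this]
  rfl

/-- Under the integral `T R_z = z R_z - 1`, and `∮ zⁿ dz` vanishes except for `n = -1`. -/
theorem mul_rieszMoment (hr : 0 < r) (hT : Metric.sphere (0 : ℂ) r ⊆ resolventSet ℂ T) (n : ℤ) :
    T * rieszMoment r T n = rieszMoment r T (n + 1) - if n = -1 then 1 else 0 := by
  have h1 := (ContinuousLinearMap.mul ℂ (X →L[ℂ] X) T).circleIntegral_comp_comm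
    (circleIntegrable_zpow_smul_resolvent hr hT n)
  have h2 : ∮ z in C(0, r), z ^ n • (1 : X →L[ℂ] X)
      = (2 * Real.pi * Complex.I : ℂ) • if n = -1 then (1 : X →L[ℂ] X) else 0 := by
    rw [circleIntegral.integral_smul_const]
    split_ifs with hn
    · subst hn
      congr 1
      simpa using circleIntegral.integral_sub_center_inv 0 hr.ne'
    · have := circleIntegral.integral_sub_zpow_of_ne hn 0 0 r
      simp only [sub_zero] at this
      rw [this, zero_smul, smul_zero]
  have h3 : ∮ z in C(0, r), ContinuousLinearMap.mul ℂ (X →L[ℂ] X) T (z ^ n • resolvent T z)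
      = ∮ z in C(0, r), (z ^ (n + 1) • resolvent T z - z ^ n • (1 : X →L[ℂ] X)) := by
    refine circleIntegral.integral_congr hr.le fun z hz => ?_
    have hz0 : z ≠ 0 := Metric.ne_of_mem_sphere hz hr.ne'
    have : T * resolvent T z = z • resolvent T z - 1 := by
      ext f
      have := smul_resolvent_apply_sub (hT hz) f
      simp only [mul_apply_eq_comp, sub_apply, smul_apply, one_apply_eq_self]
      exact eq_sub_of_add_eq (by rw [← eq_sub_iff_add_eq', this])
    simp only [ContinuousLinearMap.mul_apply']
    rw [mul_smul_comm, this, smul_sub, smul_smul, zpow_add_one₀ hz0]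
  have h4 : CircleIntegrable (fun z : ℂ => z ^ n • (1 : X →L[ℂ] X)) 0 r := by
    refine ContinuousOn.circleIntegrable hr.le (ContinuousOn.fun_smul ?_ continuousOn_const)
    exact fun z hz => (continuousAt_zpow₀ z n
      (Or.inl (Metric.ne_of_mem_sphere hz hr.ne'))).continuousWithinAt
  rw [rieszMoment, rieszMoment, mul_smul_comm, show T * _ = _ from h1.symm.trans h3,
    circleIntegral.integral_sub (circleIntegrable_zpow_smul_resolvent hr hT _) h4, h2, smul_sub,
    smul_smul, inv_mul_cancel₀ Complex.two_pi_I_ne_zero, one_smul]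

theorem commute_rieszMoment (hr : 0 < r) (hT : Metric.sphere (0 : ℂ) r ⊆ resolventSet ℂ T)
    (n : ℤ) : Commute T (rieszMoment r T n) := by
  have h1 := (ContinuousLinearMap.mul ℂ (X →L[ℂ] X) T).circleIntegral_comp_comm
    (circleIntegrable_zpow_smul_resolvent hr hT n)
  have h2 := ((ContinuousLinearMap.mul ℂ (X →L[ℂ] X)).flip T).circleIntegral_comp_comm
    (circleIntegrable_zpow_smul_resolvent hr hT n)
  have h3 : ∮ z in C(0, r), ContinuousLinearMap.mul ℂ (X →L[ℂ] X) T (z ^ n • resolvent T z)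
      = ∮ z in C(0, r), (ContinuousLinearMap.mul ℂ (X →L[ℂ] X)).flip T (z ^ n • resolvent T z) := by
    refine circleIntegral.integral_congr hr.le fun z hz => ?_
    simp only [ContinuousLinearMap.mul_apply', ContinuousLinearMap.flip_apply]
    exact ((commute_resolvent (hT hz)).smul_right (z ^ n)).eq
  rw [h1, h2] at h3
  simp only [ContinuousLinearMap.mul_apply', ContinuousLinearMap.flip_apply] at h3
  exact Commute.smul_right h3 _

theorem pow_mul_rieszMoment_zero (hr : 0 < r)
    (hT : Metric.sphere (0 : ℂ) r ⊆ resolventSet ℂ T) (n : ℕ) :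
    T ^ n * rieszMoment r T 0 = rieszMoment r T n := by
  induction n with
  | zero => simp
  | succ n ih =>
    rw [pow_succ', mul_assoc, ih, mul_rieszMoment hr hT, if_neg (by omega), sub_zero]
    simp

/-- Each factor `T` raises the index by one; the correction `-1` appears only in the last passage,
from index `-1` to `0`. -/
theorem pow_mul_rieszMoment_neg (hr : 0 < r)
    (hT : Metric.sphere (0 : ℂ) r ⊆ resolventSet ℂ T) (n : ℕ) :
    T ^ (n + 1) * rieszMoment r T (-(n + 1 : ℕ)) = rieszMoment r T 0 - 1 := by
  induction n with
  | zero => simp [mul_rieszMoment hr hT]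
  | succ n ih =>
    rw [pow_succ, mul_assoc, mul_rieszMoment hr hT, if_neg (by omega), sub_zero, ← ih]
    congr 2

/-- For every `n`, `(J_R - 1) J_r` equals the moment of index `-(n+1)` on the large circle times
that of index `n+1` on the small one. Its norm is `O((r/R)ⁿ)`, so it is zero; no double contour
integral is needed. -/
theorem rieszMoment_mul_rieszMoment_of_lt {R : ℝ} (hr : 0 < r) (hrR : r < R)
    (hT : Metric.sphere (0 : ℂ) r ⊆ resolventSet ℂ T)
    (hT' : Metric.sphere (0 : ℂ) R ⊆ resolventSet ℂ T) {M : ℝ} (hM0 : 0 ≤ M)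
    (hM : ∀ z ∈ Metric.sphere (0 : ℂ) r, ‖resolvent T z‖ ≤ M)
    (hM' : ∀ z ∈ Metric.sphere (0 : ℂ) R, ‖resolvent T z‖ ≤ M) :
    rieszMoment R T 0 * rieszMoment r T 0 = rieszMoment r T 0 := by
  have hR := hr.trans hrR
  have h1 : ∀ n : ℕ, rieszMoment R T 0 * rieszMoment r T 0 - rieszMoment r T 0
      = rieszMoment R T (-(n + 1 : ℕ)) * rieszMoment r T (n + 1 : ℕ) := by
    intro n
    rw [← pow_mul_rieszMoment_zero hr hT (n + 1), ← mul_assoc,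
      ← ((commute_rieszMoment hR hT' _).pow_left (n + 1)).eq, pow_mul_rieszMoment_neg hR hT',
      sub_mul, one_mul]
  have h2 : ∀ n : ℕ, ‖rieszMoment R T 0 * rieszMoment r T 0 - rieszMoment r T 0‖
      ≤ R * r * M * M * (r / R) ^ (n + 1) := by
    intro n
    rw [h1 n]
    refine (norm_mul_le _ _).trans ((mul_le_mul (norm_rieszMoment_le hR hM' _)
      (norm_rieszMoment_le hr hM _) (norm_nonneg _) (by positivity)).trans_eq ?_)
    rw [zpow_neg, zpow_natCast, zpow_natCast, div_pow]
    field_simp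
  have h3 : Tendsto (fun n : ℕ => R * r * M * M * (r / R) ^ (n + 1)) atTop (𝓝 0) := by
    simpa using ((tendsto_pow_atTop_nhds_zero_of_lt_one (div_nonneg hr.le hR.le)
      ((div_lt_one hR).2 hrR)).comp (tendsto_add_atTop_nat 1)).const_mul (R * r * M * M)
  exact sub_eq_zero.1 (norm_le_zero_iff.1 (ge_of_tendsto' h3 h2))

theorem rieszMoment_eq_of_annulus {R : ℝ} (hr : 0 < r) (hrR : r ≤ R)
    (hT : ∀ z : ℂ, r ≤ ‖z‖ → ‖z‖ ≤ R → z ∈ resolventSet ℂ T) :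
    rieszMoment R T 0 = rieszMoment r T 0 := by
  have hd : ∀ z : ℂ, r ≤ ‖z‖ → ‖z‖ ≤ R →
      DifferentiableAt ℂ (fun z : ℂ => z ^ (0 : ℤ) • resolvent T z) z := fun z h1 h2 => by
    simpa using (spectrum.hasDerivAt_resolvent_const_left (hT z h1 h2)).differentiableAt
  rw [rieszMoment, rieszMoment]
  congr 1
  refine Complex.circleIntegral_eq_of_differentiable_on_annulus_off_countable hr hrR
    countable_empty (fun z hz => ?_) fun z hz => ?_
  · simp only [Set.mem_sdiff, Metric.mem_closedBall, Metric.mem_ball, dist_zero_right, not_lt] at hz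
    exact (hd z hz.2 hz.1).continuousAt.continuousWithinAt
  · simp only [Set.mem_sdiff, Metric.mem_closedBall, Metric.mem_ball, dist_zero_right, not_le] at hz
    exact hd z hz.1.2.le hz.1.1.le

theorem rieszMoment_apply_of_eigenvector_inside (hr : 0 < r)
    (hT : Metric.sphere (0 : ℂ) r ⊆ resolventSet ℂ T) {μ : ℂ} {f : X} (hf : T f = μ • f)
    (hμ : ‖μ‖ < r) : rieszMoment r T 0 f = f := by
  rw [rieszMoment_apply hr hT]
  have : ∮ z in C(0, r), z ^ (0 : ℤ) • resolvent T z f = ∮ z in C(0, r), (z - μ)⁻¹ • f := by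
    refine circleIntegral.integral_congr hr.le fun z hz => ?_
    simp only [zpow_zero, one_smul]
    refine resolvent_apply_of_eigenvector (hT hz) hf ?_
    rintro rfl
    exact hμ.ne (mem_sphere_zero_iff_norm.1 hz)
  rw [this, circleIntegral.integral_smul_const, circleIntegral.integral_sub_inv_of_mem_ball
    (mem_ball_zero_iff.2 hμ), smul_smul, inv_mul_cancel₀ Complex.two_pi_I_ne_zero, one_smul]

theorem rieszMoment_apply_of_eigenvector_outside (hr : 0 < r)
    (hT : Metric.sphere (0 : ℂ) r ⊆ resolventSet ℂ T) {μ : ℂ} {f : X} (hf : T f = μ • f)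
    (hμ : r < ‖μ‖) : rieszMoment r T 0 f = 0 := by
  rw [rieszMoment_apply hr hT]
  have hne : ∀ z ∈ Metric.closedBall (0 : ℂ) r, z ≠ μ := by
    rintro z hz rfl
    exact (mem_closedBall_zero_iff.1 hz).not_gt hμ
  have : ∮ z in C(0, r), z ^ (0 : ℤ) • resolvent T z f = ∮ z in C(0, r), (z - μ)⁻¹ • f := by
    refine circleIntegral.integral_congr hr.le fun z hz => ?_
    simp only [zpow_zero, one_smul]
    exact resolvent_apply_of_eigenvector (hT hz) hf (hne z (Metric.sphere_subset_closedBall hz))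
  have h0 : ∮ z in C(0, r), (z - μ)⁻¹ = 0 := by
    refine DiffContOnCl.circleIntegral_eq_zero hr.le (DifferentiableOn.diffContOnCl ?_)
    intro z hz
    refine DifferentiableAt.differentiableWithinAt ?_
    exact (differentiableAt_id.sub_const μ).inv (sub_ne_zero.2
      (hne z (Metric.closure_ball_subset_closedBall hz)))
  rw [this, circleIntegral.integral_smul_const, h0, zero_smul, smul_zero]

/-- Weak closeness of the resolvents on the circle gives weak closeness of the moments. -/
theorem norm_apply_rieszMoment_sub_le {W : Type*} [NormedAddCommGroup W] [NormedSpace ℂ W]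
    [CompleteSpace W] (Λ : X →L[ℂ] W) {T' : X →L[ℂ] X} (hr : 0 < r)
    (hT : Metric.sphere (0 : ℂ) r ⊆ resolventSet ℂ T)
    (hT' : Metric.sphere (0 : ℂ) r ⊆ resolventSet ℂ T') {f : X} {δ : ℝ}
    (h : ∀ z ∈ Metric.sphere (0 : ℂ) r, ‖Λ (resolvent T z f - resolvent T' z f)‖ ≤ δ) :
    ‖Λ (rieszMoment r T 0 f - rieszMoment r T' 0 f)‖ ≤ r * δ := by
  have hi : ∀ S : X →L[ℂ] X, Metric.sphere (0 : ℂ) r ⊆ resolventSet ℂ S →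
      CircleIntegrable (fun z => z ^ (0 : ℤ) • resolvent S z f) 0 r := by
    intro S hS
    refine ContinuousOn.circleIntegrable hr.le ?_
    simp only [zpow_zero, one_smul]
    exact ((continuousOn_resolvent S).mono hS).clm_apply continuousOn_const
  rw [rieszMoment_apply hr hT, rieszMoment_apply hr hT', ← smul_sub,
    ← circleIntegral.integral_sub (hi T hT) (hi T' hT'), map_smul,
    ← Λ.circleIntegral_comp_comm (f := fun z => z ^ (0 : ℤ) • resolvent T z f -
      z ^ (0 : ℤ) • resolvent T' z f) ((hi T hT).sub (hi T' hT'))]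
  refine circleIntegral.norm_two_pi_i_inv_smul_integral_le_of_norm_le_const hr.le fun z hz => ?_
  simpa using h z hz

end RieszMoment

/-! ### The dominating eigenvalue -/

section DominatingEigenpair

theorem mem_resolventDomain_of_annulus {κ : ℝ} {z : ℂ} (h1 : κ ≤ ‖z‖)
    (h2 : ‖z‖ ≤ (1 + κ) / 2) : z ∈ resolventDomain κ := by
  refine ⟨h1, ?_⟩
  have := norm_sub_norm_le (1 : ℂ) z
  rw [norm_one, norm_sub_rev] at this
  linarith

theorem sphere_subset_resolventDomain {κ r : ℝ} (h1 : κ ≤ r) (h2 : r ≤ (1 + κ) / 2) :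
    Metric.sphere (0 : ℂ) r ⊆ resolventDomain κ := fun z hz => by
  rw [mem_sphere_zero_iff_norm] at hz
  exact mem_resolventDomain_of_annulus (h1.trans_eq hz.symm) (hz.trans_le h2)

theorem sphere_self_subset_resolventDomain {κ : ℝ} (hκ : κ < 1) :
    Metric.sphere (0 : ℂ) κ ⊆ resolventDomain κ :=
  sphere_subset_resolventDomain le_rfl (by linarith)

variable {X : Type*} [NormedAddCommGroup X] [NormedSpace ℂ X]

/-- The spectral projection of `T` outside the disc `|z| < r`. -/
def rieszProj (r : ℝ) (T : X →L[ℂ] X) : X →L[ℂ] X := 1 - rieszMoment r T 0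

/-- The eigenvalue of `T` outside the disc `|z| < r`, when the corresponding spectral projection
has rank one; `φ` and `e` normalize the eigenvector. -/
def rieszEigenvalue (r : ℝ) (φ : X →L[ℂ] ℂ) (e : X) (T : X →L[ℂ] X) : ℂ :=
  φ (T (rieszProj r T e)) / φ (rieszProj r T e)

/-- The seminorm `f ↦ ‖Λ f‖`. -/
def weakSeminorm {W : Type*} [NormedAddCommGroup W] [NormedSpace ℂ W] (Λ : X →L[ℂ] W) :
    Seminorm ℂ X := (normSeminorm ℂ W).comp Λ.toLinearMap

@[simp] theorem weakSeminorm_apply {W : Type*} [NormedAddCommGroup W] [NormedSpace ℂ W]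
    (Λ : X →L[ℂ] W) (f : X) : weakSeminorm Λ f = ‖Λ f‖ := rfl

variable [CompleteSpace X] {κ M : ℝ} {T : X →L[ℂ] X}

/-- The annulus `κ ≤ |z| ≤ (1 + κ)/2` lies in `𝒟_κ`, so its two boundary circles give the same
moment, and the product formula for nested circles becomes idempotence. -/
theorem isIdempotentElem_rieszMoment (hκ0 : 0 < κ) (hκ1 : κ < 1) (hM0 : 0 ≤ M)
    (hT : ∀ z ∈ resolventDomain κ, z ∈ resolventSet ℂ T ∧ ‖resolvent T z‖ ≤ M) :
    rieszMoment κ T 0 * rieszMoment κ T 0 = rieszMoment κ T 0 := by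
  have h1 := sphere_self_subset_resolventDomain hκ1
  have h2 : Metric.sphere (0 : ℂ) ((1 + κ) / 2) ⊆ resolventDomain κ :=
    sphere_subset_resolventDomain (by linarith) le_rfl
  have := rieszMoment_mul_rieszMoment_of_lt hκ0 (show κ < (1 + κ) / 2 by linarith)
    (fun z hz => (hT z (h1 hz)).1) (fun z hz => (hT z (h2 hz)).1) hM0
    (fun z hz => (hT z (h1 hz)).2) (fun z hz => (hT z (h2 hz)).2)
  rwa [rieszMoment_eq_of_annulus hκ0 (by linarith)
    fun z h1 h2 => (hT z (mem_resolventDomain_of_annulus h1 h2)).1] at this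

theorem rieszMoment_neg_apply_pow (hκ0 : 0 < κ)
    (hT : Metric.sphere (0 : ℂ) κ ⊆ resolventSet ℂ T) {n : ℕ} (hn : 1 ≤ n) (f : X) :
    rieszMoment κ T (-(n : ℤ)) ((T ^ n) f) = rieszMoment κ T 0 f - f := by
  obtain ⟨n, rfl⟩ : ∃ k, n = k + 1 := ⟨n - 1, by omega⟩
  have h := pow_mul_rieszMoment_neg hκ0 hT n
  rw [((commute_rieszMoment hκ0 hT _).pow_left (n + 1)).eq] at h
  exact DFunLike.congr_fun h f

/-- `J_0 - 1` is a negative moment composed with `Tⁿ`, so the part of `f` outside the disc is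
controlled by the growth of `Tⁿ f` relative to `κⁿ`. -/
theorem norm_sub_rieszMoment_le (hκ0 : 0 < κ)
    (hT : Metric.sphere (0 : ℂ) κ ⊆ resolventSet ℂ T)
    (hM : ∀ z ∈ Metric.sphere (0 : ℂ) κ, ‖resolvent T z‖ ≤ M) {n : ℕ} (hn : 1 ≤ n) (f : X) :
    ‖f - rieszMoment κ T 0 f‖ ≤ κ * M * (κ⁻¹ ^ n * ‖(T ^ n) f‖) := by
  rw [norm_sub_rev, ← rieszMoment_neg_apply_pow hκ0 hT hn]
  refine (ContinuousLinearMap.le_opNorm _ _).trans ((mul_le_mul_of_nonneg_right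
    (norm_rieszMoment_le hκ0 hM _) (norm_nonneg _)).trans_eq ?_)
  rw [zpow_neg, zpow_natCast, inv_pow]
  ring

/-- The complementary projection of the limit of `T ^ n` is the spectral projection associated
with a disc in which `T ^ n` converges. -/
theorem rieszMoment_apply_of_ker {P : X →L[ℂ] X} (hκ0 : 0 < κ)
    (hT : Metric.sphere (0 : ℂ) κ ⊆ resolventSet ℂ T)
    (hM : ∀ z ∈ Metric.sphere (0 : ℂ) κ, ‖resolvent T z‖ ≤ M) (hPT : P * T = P)
    (hrate : ∃ n : ℕ, 1 ≤ n ∧ ‖T ^ n - P‖ < κ ^ n) {f : X} (hf : P f = 0) :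
    rieszMoment κ T 0 f = f := by
  obtain ⟨n, hn1, hn⟩ := hrate
  have hPpow : ∀ k : ℕ, P ((T ^ k) f) = 0 := by
    intro k
    induction k with
    | zero => simpa
    | succ k ih =>
      rw [pow_succ', mul_apply_eq_comp, ← mul_apply_eq_comp P T, hPT, ih]
  set q := ‖T ^ n - P‖ with hq
  -- On `ker P`, invariant since `P T = P`, the operator `Tⁿ` coincides with `Tⁿ - P`. The iterates
  -- thus decay faster than `κ^(n j)`, which forces `f - J_0 f = 0`.
  have hpow : ∀ j : ℕ, ‖(T ^ (n * j)) f‖ ≤ q ^ j * ‖f‖ := by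
    intro j
    induction j with
    | zero => simp
    | succ j ih =>
      have : (T ^ (n * (j + 1))) f = (T ^ n - P) ((T ^ (n * j)) f) := by
        rw [sub_apply, hPpow, sub_zero, mul_add, mul_one, add_comm, pow_add, mul_apply_eq_comp]
      rw [this, pow_succ', mul_assoc]
      exact (ContinuousLinearMap.le_opNorm _ _).trans (by gcongr)
  have hb : ∀ j : ℕ, ‖f - rieszMoment κ T 0 f‖ ≤ κ * M * ‖f‖ * (q / κ ^ n) ^ (j + 1) := by
    intro j
    have hM0 : 0 ≤ M := (norm_nonneg _).trans (hM κ (by simp [abs_of_pos hκ0]))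
    refine (norm_sub_rieszMoment_le hκ0 hT hM (n := n * (j + 1))
      (Nat.mul_pos (by omega) (by omega)) f).trans ?_
    calc κ * M * (κ⁻¹ ^ (n * (j + 1)) * ‖(T ^ (n * (j + 1))) f‖)
        ≤ κ * M * (κ⁻¹ ^ (n * (j + 1)) * (q ^ (j + 1) * ‖f‖)) := by
          gcongr
          exact hpow (j + 1)
      _ = _ := by rw [div_pow, pow_mul, inv_pow, inv_pow]; ring
  have hlim : Tendsto (fun j : ℕ => κ * M * ‖f‖ * (q / κ ^ n) ^ (j + 1)) atTop (𝓝 0) := by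
    simpa using ((tendsto_pow_atTop_nhds_zero_of_lt_one (by positivity)
      ((div_lt_one (by positivity)).2 hn)).comp (tendsto_add_atTop_nat 1)).const_mul (κ * M * ‖f‖)
  exact (sub_eq_zero.1 (norm_le_zero_iff.1 (ge_of_tendsto' hlim hb))).symm

/-- If `k` is in the spectrum, `kⁿ` is in that of `Nⁿ`; so `(|k|/κ)ⁿ` stays bounded and `|k| ≤ κ`.
-/
theorem spectralRadius_le_of_pow_le {N : X →L[ℂ] X} {κ K : ℝ} (hκ0 : 0 < κ)
    (h : ∀ n : ℕ, 1 ≤ n → ‖N ^ n‖ ≤ K * κ ^ n) : spectralRadius ℂ N ≤ ENNReal.ofReal κ := by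
  refine iSup₂_le fun k hk => ?_
  rw [← enorm_eq_nnnorm, ← ofReal_norm]
  refine ENNReal.ofReal_le_ofReal ?_
  by_contra! hlt
  have hpow : ∀ n : ℕ, 1 ≤ n → (‖k‖ / κ) ^ n ≤ K * ‖(1 : X →L[ℂ] X)‖ := by
    intro n hn
    have hmem : k ^ n ∈ spectrum ℂ (N ^ n) := spectrum.pow_mem_pow N n hk
    have := spectrum.norm_le_norm_mul_of_mem hmem
    rw [norm_pow] at this
    rw [div_pow, div_le_iff₀ (by positivity)]
    refine this.trans ((mul_le_mul_of_nonneg_right (h n hn) (norm_nonneg _)).trans_eq ?_)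
    ring
  have hlim := tendsto_pow_atTop_atTop_of_one_lt ((one_lt_div hκ0).2 hlt)
  obtain ⟨n, hn1, hn2⟩ := ((hlim.eventually_gt_atTop (K * ‖(1 : X →L[ℂ] X)‖)).and
    (eventually_ge_atTop 1)).exists
  exact (hpow n hn2).not_gt hn1

/-- By `huniq`, `φ` is injective on `ker J_0`, which is the range of `Π = 1 - J_0`. As `φ(Πe) ≠ 0`,
this range is the line through `Πe`, and `T` preserves it because `T` commutes with `Π`. Then `T -
λΠ = T J_0`, with powers `Tⁿ J_0 = J_n`. -/
theorem isDominatingEigenpair_rieszProj (hκ0 : 0 < κ) (hκ1 : κ < 1) (hM0 : 0 ≤ M)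
    (hT : ∀ z ∈ resolventDomain κ, z ∈ resolventSet ℂ T ∧ ‖resolvent T z‖ ≤ M)
    {φ : X →L[ℂ] ℂ} {e : X} (huniq : ∀ f, rieszMoment κ T 0 f = 0 → φ f = 0 → f = 0)
    (he : φ (rieszProj κ T e) ≠ 0) :
    IsDominatingEigenpair T (rieszEigenvalue κ φ e T) (rieszProj κ T) ∧
      ∀ n : ℕ, 1 ≤ n →
        (T - rieszEigenvalue κ φ e T • rieszProj κ T) ^ n = rieszMoment κ T n := by
  have hsub := sphere_self_subset_resolventDomain hκ1
  have hTs : Metric.sphere (0 : ℂ) κ ⊆ resolventSet ℂ T := fun z hz => (hT z (hsub hz)).1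
  have hMs : ∀ z ∈ Metric.sphere (0 : ℂ) κ, ‖resolvent T z‖ ≤ M := fun z hz => (hT z (hsub hz)).2
  have hJ := isIdempotentElem_rieszMoment hκ0 hκ1 hM0 hT
  have hcomm := commute_rieszMoment hκ0 hTs 0
  set J := rieszMoment κ T 0 with hJdef
  have hR : rieszProj κ T = 1 - J := rfl
  set R := rieszProj κ T
  have hRR : R * R = R := (IsIdempotentElem.one_sub hJ : IsIdempotentElem (1 - J))
  have hJR : J * R = 0 := by rw [hR, mul_sub, hJ, mul_one, sub_self]
  have hTR : Commute T R := (Commute.one_right T).sub_right hcomm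
  set v := R e
  set lam := rieszEigenvalue κ φ e T with hlam
  have hv0 : v ≠ 0 := fun h => he (by rw [h, map_zero])
  have hspan : ∀ w, J w = 0 → w = (φ w / φ v) • v := by
    intro w hw
    refine sub_eq_zero.1 (huniq _ ?_ ?_)
    · rw [map_sub, map_smul, hw, ← mul_apply_eq_comp J R e, hJR]
      simp
    · rw [map_sub, map_smul, smul_eq_mul, div_mul_cancel₀ _ he, sub_self]
  have hJRf : ∀ f, J (R f) = 0 := fun f => DFunLike.congr_fun hJR f
  have hTv : T v = lam • v := by
    refine hspan (T v) ?_
    rw [← mul_apply_eq_comp T R e, hTR.eq]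
    exact hJRf _
  have hTR' : T * R = lam • R := by
    ext f
    rw [mul_apply_eq_comp, smul_apply, hspan (R f) (hJRf f), map_smul, hTv, smul_comm]
  have hN : T - lam • R = T * J := by
    rw [← hTR', hR, mul_sub, mul_one, sub_sub_cancel]
  have hNpow : ∀ n : ℕ, 1 ≤ n → (T - lam • R) ^ n = rieszMoment κ T n := by
    intro n hn
    rw [hN, hcomm.mul_pow, (show IsIdempotentElem J from hJ).pow_eq (by omega),
      pow_mul_rieszMoment_zero hκ0 hTs]
  refine ⟨⟨hRR, ?_, hTR', hTR.eq.symm.trans hTR', ?_⟩, hNpow⟩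
  · refine finrank_eq_one_iff'.2 ⟨⟨v, ⟨e, rfl⟩⟩, ?_, ?_⟩
    · simpa [Subtype.ext_iff] using hv0
    · rintro ⟨_, f, rfl⟩
      refine ⟨φ (R f) / φ v, Subtype.ext ?_⟩
      exact (hspan (R f) (hJRf f)).symm
  -- An eigenvalue cannot lie in `𝒟_κ`, and `|λ| < κ` would give `J_0 v = v`, whereas `J_0 v = 0`.
  -- Hence `|λ - 1| < (1 - κ)/2`, so `|λ| > κ`, while the moments bound the spectral radius of the
  -- rest by `κ`.
  · have hlamD : lam ∉ resolventDomain κ := fun h => by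
      have := resolvent_apply_sub (hT lam h).1 v
      rw [hTv, sub_self, map_zero] at this
      exact hv0 this.symm
    have hlamκ : κ ≤ ‖lam‖ := by
      by_contra! h
      have := rieszMoment_apply_of_eigenvector_inside hκ0 hTs hTv h
      rw [← hJdef, hJRf] at this
      exact hv0 this.symm
    have hlam' : κ < ‖lam‖ := by
      have h1 : ‖lam - 1‖ < (1 - κ) / 2 := by
        by_contra! h
        exact hlamD ⟨hlamκ, h⟩
      have h2 := norm_sub_norm_le (1 : ℂ) lam
      rw [norm_one, norm_sub_rev] at h2
      linarith
    have h1 := spectralRadius_le_of_pow_le (N := T - lam • R) (κ := κ) (K := κ * M) hκ0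
      fun n hn => by
        rw [hNpow n hn]
        refine (norm_rieszMoment_le hκ0 hMs _).trans_eq ?_
        rw [zpow_natCast]
        ring
    refine h1.trans_lt ?_
    rw [← enorm_eq_nnnorm, ← ofReal_norm]
    exact (ENNReal.ofReal_lt_ofReal_iff (hκ0.trans hlam')).2 hlam'

/-- Under the conclusions of the Keller–Liverani theorem, and if the limit of `T₀ ^ n` has rank
one, then `T t` has a dominating eigenvalue. -/
theorem eventually_isDominatingEigenpair {W : Type*} [NormedAddCommGroup W] [NormedSpace ℂ W]
    [CompleteSpace W] {Λ : X →L[ℂ] W} {ι : Type*} {l : Filter ι} {T : ι → X →L[ℂ] X}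
    {T₀ P : X →L[ℂ] X} {κ₁ C : ℝ} (hκ₁ : 0 ≤ κ₁) (hC : 0 ≤ C) (hκ : κ₁ < κ) (hκ1 : κ < 1)
    (hM0 : 0 < M) (hDF : ∀ᶠ t in l, DoeblinFortet (weakSeminorm Λ) κ₁ C (T t))
    (hT₀ : ∀ z ∈ resolventDomain κ, z ∈ resolventSet ℂ T₀ ∧ ‖resolvent T₀ z‖ ≤ M)
    (hT : ∀ᶠ t in l, ∀ z ∈ resolventDomain κ,
      z ∈ resolventSet ℂ (T t) ∧ ‖resolvent (T t) z‖ ≤ M)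
    (hweak : ∀ δ > 0, ∀ᶠ t in l, ∀ z ∈ resolventDomain κ, ∀ f,
      weakSeminorm Λ (resolvent (T t) z f - resolvent T₀ z f) ≤ δ * ‖f‖)
    (hP : P * T₀ = P) (hrate : ∃ n : ℕ, 1 ≤ n ∧ ‖T₀ ^ n - P‖ < κ ^ n)
    {φ : X →L[ℂ] ℂ} {e : X} (hφΛ : ∀ f, ‖φ f‖ ≤ ‖Λ f‖) (hPφ : ∀ f, φ f = 0 → P f = 0)
    (he : T₀ e = e) (hφe : φ e = 1) :
    ∀ᶠ t in l, φ (rieszProj κ (T t) e) ≠ 0 ∧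
      IsDominatingEigenpair (T t) (rieszEigenvalue κ φ e (T t)) (rieszProj κ (T t)) ∧
      ∀ n : ℕ, 1 ≤ n →
        (T t - rieszEigenvalue κ φ e (T t) • rieszProj κ (T t)) ^ n = rieszMoment κ (T t) n := by
  have hκ0 : 0 < κ := hκ₁.trans_lt hκ
  have hsub := sphere_self_subset_resolventDomain hκ1
  have hs₀ : Metric.sphere (0 : ℂ) κ ⊆ resolventSet ℂ T₀ := fun z hz => (hT₀ z (hsub hz)).1
  obtain ⟨n, hn1, hn⟩ := exists_geom_le hκ₁ hκ (κ * M * C) (half_pos one_pos)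
  -- The first entry makes `|φ(J_0(t) e)| ≤ 1/2`, so that `φ(Π(t) e) ≠ 0`; the second yields the
  -- quarter in `h4`. The `+ 1`s keep the denominators positive.
  set δ : ℝ := min (2 * κ * (‖e‖ + 1))⁻¹ (4 * (κ * M * (κ⁻¹ ^ n * (C + 1)) * κ))⁻¹
  have hδ : 0 < δ := lt_min (by positivity) (by positivity)
  filter_upwards [hDF, hT, hweak δ hδ] with t hDFt hTt hwt
  have hs : Metric.sphere (0 : ℂ) κ ⊆ resolventSet ℂ (T t) := fun z hz => (hTt z (hsub hz)).1
  have hJ : ∀ f, ‖Λ (rieszMoment κ (T t) 0 f - rieszMoment κ T₀ 0 f)‖ ≤ κ * (δ * ‖f‖) :=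
    fun f => norm_apply_rieszMoment_sub_le Λ hκ0 hs hs₀ fun z hz => hwt z (hsub hz) f
  have hφ : φ (rieszProj κ (T t) e) ≠ 0 := by
    have h0 : rieszMoment κ T₀ 0 e = 0 :=
      rieszMoment_apply_of_eigenvector_outside hκ0 hs₀ (μ := 1) (by simpa using he) (by simpa)
    have h1 := (hφΛ _).trans (hJ e)
    rw [h0, sub_zero] at h1
    have h2 : κ * (δ * ‖e‖) ≤ 1 / 2 := by
      calc κ * (δ * ‖e‖) ≤ κ * ((2 * κ * (‖e‖ + 1))⁻¹ * (‖e‖ + 1)) := by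
            gcongr
            · exact min_le_left _ _
            · linarith
        _ = 1 / 2 := by field_simp
    intro h
    rw [rieszProj, sub_apply, one_apply_eq_self, map_sub, hφe, sub_eq_zero] at h
    rw [← h, norm_one] at h1
    linarith
  refine ⟨hφ, isDominatingEigenpair_rieszProj hκ0 hκ1 hM0.le hTt (fun f hf hφf => ?_) hφ⟩
  -- Since `φ f = 0`, the unperturbed moment fixes `f`, whereas the perturbed one kills it; so `‖Λ
  -- f‖` is small relative to `‖f‖`. As `J_0(t) f = 0` also bounds `‖f‖` by a multiple of `‖T(t)ⁿ
  -- f‖`, Doeblin–Fortet gives `‖f‖ ≤ (3/4) ‖f‖`.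
  have h1 := rieszMoment_apply_of_ker hκ0 hs₀ (fun z hz => (hT₀ z (hsub hz)).2) hP hrate (hPφ f hφf)
  have h2 := hJ f
  rw [hf, h1, zero_sub, map_neg, norm_neg] at h2
  have h3 := norm_sub_rieszMoment_le hκ0 hs (fun z hz => (hTt z (hsub hz)).2) hn1 f
  rw [hf, sub_zero] at h3
  have h4 : ‖f‖ ≤ 1 / 2 * ‖f‖ + 1 / 4 * ‖f‖ := by
    calc ‖f‖ ≤ κ * M * (κ⁻¹ ^ n * ‖(T t ^ n) f‖) := h3
      _ ≤ κ * M * (κ⁻¹ ^ n * (C * κ₁ ^ n * ‖f‖ + C * (κ * (δ * ‖f‖)))) := by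
          gcongr
          exact (hDFt.pow_le n hn1 f).trans (by gcongr; exact h2)
      _ = κ * M * C * (κ₁ / κ) ^ n * ‖f‖ + κ * M * (κ⁻¹ ^ n * C) * κ * δ * ‖f‖ := by
          rw [div_eq_mul_inv, mul_pow]; ring
      _ ≤ 1 / 2 * ‖f‖ + κ * M * (κ⁻¹ ^ n * (C + 1)) * κ *
            (4 * (κ * M * (κ⁻¹ ^ n * (C + 1)) * κ))⁻¹ * ‖f‖ := by
          gcongr
          · linarith
          · exact min_le_right _ _
      _ = _ := by field_simp
  exact norm_le_zero_iff.1 (by linarith)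

end DominatingEigenpair

/-! ### Spaces of bounded continuous functions of the spectral parameter -/

section BoundedFunctions

open BoundedContinuousFunction

variable {D : Type*} [TopologicalSpace D]

section

variable {X Y : Type*} [NormedAddCommGroup X] [NormedSpace ℂ X] [NormedAddCommGroup Y]
  [NormedSpace ℂ Y]

/-- The action of a bounded operator on bounded continuous functions, as a function of the
operator. -/
def bcfMap (D : Type*) [TopologicalSpace D] (X Y : Type*) [NormedAddCommGroup X] [NormedSpace ℂ X]
    [NormedAddCommGroup Y] [NormedSpace ℂ Y] :
    (X →L[ℂ] Y) →L[ℂ] ((D →ᵇ X) →L[ℂ] (D →ᵇ Y)) :=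
  LinearMap.mkContinuous
    { toFun := fun A => A.compLeftContinuousBounded D
      map_add' := fun A B => by ext; simp
      map_smul' := fun c A => by ext; simp } 1 fun A => by
    refine ContinuousLinearMap.opNorm_le_bound _ (by positivity) fun f => ?_
    rw [one_mul, BoundedContinuousFunction.norm_le (by positivity)]
    exact fun z => (A.le_opNorm _).trans (by gcongr; exact f.norm_coe_le_norm z)

@[simp] theorem bcfMap_apply (A : X →L[ℂ] Y) (f : D →ᵇ X) (z : D) :
    bcfMap D X Y A f z = A (f z) := rfl

theorem norm_bcf_apply_apply_le (R : D →ᵇ (X →L[ℂ] Y)) (f : D →ᵇ X) (z : D) :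
    ‖R z (f z)‖ ≤ ‖R‖ * ‖f‖ :=
  (ContinuousLinearMap.le_opNorm _ _).trans
    (mul_le_mul (R.norm_coe_le_norm z) (f.norm_coe_le_norm z) (norm_nonneg _) (by positivity))

/-- The diagonal operator defined by a bounded continuous family of operators. -/
def bcfDiag (R : D →ᵇ (X →L[ℂ] Y)) : (D →ᵇ X) →L[ℂ] (D →ᵇ Y) :=
  LinearMap.mkContinuous
    { toFun := fun f => BoundedContinuousFunction.ofNormedAddCommGroup (fun z => R z (f z))
        (R.continuous.clm_apply f.continuous) (‖R‖ * ‖f‖)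
        (norm_bcf_apply_apply_le R f)
      map_add' := fun f g => by ext; simp
      map_smul' := fun c f => by ext; simp } ‖R‖ fun f =>
    BoundedContinuousFunction.norm_ofNormedAddCommGroup_le _ (by positivity)
      (norm_bcf_apply_apply_le R f)

@[simp] theorem bcfDiag_apply (R : D →ᵇ (X →L[ℂ] Y)) (f : D →ᵇ X) (z : D) :
    bcfDiag R f z = R z (f z) := rfl

theorem norm_bcfDiag_le (R : D →ᵇ (X →L[ℂ] Y)) : ‖bcfDiag R‖ ≤ ‖R‖ :=
  ContinuousLinearMap.opNorm_le_bound _ (by positivity) fun f =>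
    BoundedContinuousFunction.norm_ofNormedAddCommGroup_le _ (by positivity)
      (norm_bcf_apply_apply_le R f)

/-- The constant functions. -/
def bcfConst (D : Type*) [TopologicalSpace D] (X : Type*) [NormedAddCommGroup X]
    [NormedSpace ℂ X] : X →L[ℂ] (D →ᵇ X) :=
  LinearMap.mkContinuous
    { toFun := fun f => BoundedContinuousFunction.const D f
      map_add' := fun f g => by ext; simp
      map_smul' := fun c f => by ext; simp } 1 fun f => by
    rw [one_mul]
    exact BoundedContinuousFunction.norm_const_le f

@[simp] theorem bcfConst_apply (f : X) (z : D) : bcfConst D X f z = f := rfl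

theorem norm_bcfConst_le : ‖bcfConst D X‖ ≤ 1 := LinearMap.mkContinuous_norm_le _ zero_le_one _

/-- Compression of an operator on bounded functions by the constants on the right, and by `L` on
the left. -/
def bcfCompress (L : (D →ᵇ Y) →L[ℂ] Y) :
    ((D →ᵇ X) →L[ℂ] (D →ᵇ Y)) →L[ℝ] (X →L[ℂ] Y) :=
  (compRightReal (bcfConst D X)).comp (compLeftReal L)

@[simp] theorem bcfCompress_apply (L : (D →ᵇ Y) →L[ℂ] Y) (A : (D →ᵇ X) →L[ℂ] (D →ᵇ Y)) (f : X) :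
    bcfCompress L A f = L (A (bcfConst D X f)) := rfl

/-- One bound on the derivatives of the operator on bounded functions thereby serves every `z`
(evaluations, of norm at most `1`) and every `n` (contour moments, of norm at most `r · rⁿ`). -/
theorem norm_bcfCompress_le (L : (D →ᵇ Y) →L[ℂ] Y) :
    ‖(bcfCompress L : ((D →ᵇ X) →L[ℂ] (D →ᵇ Y)) →L[ℝ] (X →L[ℂ] Y))‖ ≤ ‖L‖ := by
  refine ContinuousLinearMap.opNorm_le_bound _ (norm_nonneg _) fun A => ?_
  refine ContinuousLinearMap.opNorm_le_bound _ (by positivity) fun f => ?_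
  rw [bcfCompress_apply, mul_assoc]
  refine (L.le_opNorm _).trans ?_
  gcongr
  refine (A.le_opNorm _).trans ?_
  gcongr
  exact ((bcfConst D X).le_of_opNorm_le norm_bcfConst_le f).trans_eq (one_mul _)

end

section Contour

variable {D : Set ℂ} {X : Type*} [NormedAddCommGroup X]

open Classical in
/-- Extension by zero of a function on `D`. -/
def extendZero (g : D → X) (z : ℂ) : X := if h : z ∈ D then g ⟨z, h⟩ else 0

theorem extendZero_of_mem (g : D → X) {z : ℂ} (h : z ∈ D) : extendZero g z = g ⟨z, h⟩ := dif_pos h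

theorem continuousOn_extendZero (g : D →ᵇ X) : ContinuousOn (extendZero g) D := by
  rw [continuousOn_iff_continuous_domRestrict]
  convert g.continuous using 1
  ext z
  exact extendZero_of_mem g z.2

variable [NormedSpace ℂ X]

theorem circleIntegrable_zpow_smul_extendZero {r : ℝ} (hr : 0 < r)
    (hD : Metric.sphere (0 : ℂ) r ⊆ D) (n : ℤ) (g : D →ᵇ X) :
    CircleIntegrable (fun z => z ^ n • extendZero g z) 0 r := by
  refine ContinuousOn.circleIntegrable hr.le (ContinuousOn.fun_smul ?_
    ((continuousOn_extendZero g).mono hD))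
  exact fun z hz => (continuousAt_zpow₀ z n
    (Or.inl (Metric.ne_of_mem_sphere hz hr.ne'))).continuousWithinAt

/-- The contour integral `g ↦ (2πi)⁻¹ ∮ zⁿ g(z) dz` over the circle `|z| = r`. -/
def contourMoment (X : Type*) [NormedAddCommGroup X] [NormedSpace ℂ X] {r : ℝ} (hr : 0 < r)
    (hD : Metric.sphere (0 : ℂ) r ⊆ D) (n : ℤ) : (D →ᵇ X) →L[ℂ] X :=
  LinearMap.mkContinuous
    { toFun := fun g => (2 * Real.pi * Complex.I : ℂ)⁻¹ • ∮ z in C(0, r), z ^ n • extendZero g z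
      map_add' := fun f g => by
        rw [← smul_add, ← circleIntegral.integral_add
          (circleIntegrable_zpow_smul_extendZero hr hD n f)
          (circleIntegrable_zpow_smul_extendZero hr hD n g)]
        congr 1
        refine circleIntegral.integral_congr hr.le fun z hz => ?_
        simp [extendZero_of_mem _ (hD hz)]
      map_smul' := fun c g => by
        have : ∮ z in C(0, r), z ^ n • extendZero (c • g) z
            = c • ∮ z in C(0, r), z ^ n • extendZero g z := by
          rw [← circleIntegral.integral_smul]
          refine circleIntegral.integral_congr hr.le fun z hz => ?_
          simp only [extendZero_of_mem _ (hD hz)]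
          exact smul_comm (z ^ n) c (g ⟨z, hD hz⟩)
        rw [RingHom.id_apply, smul_comm c, ← this] } (r * r ^ n) fun g => by
    refine (circleIntegral.norm_two_pi_i_inv_smul_integral_le_of_norm_le_const hr.le
      (C := r ^ n * ‖g‖) fun z hz => ?_).trans_eq (mul_assoc _ _ _).symm
    rw [norm_smul, norm_zpow, mem_sphere_zero_iff_norm.1 hz, extendZero_of_mem _ (hD hz)]
    gcongr
    exact g.norm_coe_le_norm _

theorem contourMoment_apply {r : ℝ} (hr : 0 < r) (hD : Metric.sphere (0 : ℂ) r ⊆ D) (n : ℤ)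
    (g : D →ᵇ X) : contourMoment X hr hD n g =
      (2 * Real.pi * Complex.I : ℂ)⁻¹ • ∮ z in C(0, r), z ^ n • extendZero g z := rfl

theorem norm_contourMoment_le {r : ℝ} (hr : 0 < r) (hD : Metric.sphere (0 : ℂ) r ⊆ D) (n : ℤ) :
    ‖contourMoment X hr hD n‖ ≤ r * r ^ n :=
  LinearMap.mkContinuous_norm_le _ (by positivity) _

end Contour

end BoundedFunctions

/-! ### Uniform smoothness of the resolvent -/

section UniformResolvent

open BoundedContinuousFunction

variable {X : Type*} [NormedAddCommGroup X] [NormedSpace ℂ X]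

/-- `D` is contained in the resolvent set of `T`, and the resolvent is bounded by `M` on `D`. -/
def ResolventBddOn (D : Set ℂ) (M : ℝ) (T : X →L[ℂ] X) : Prop :=
  ∀ z ∈ D, z ∈ resolventSet ℂ T ∧ ‖resolvent T z‖ ≤ M

variable [CompleteSpace X]

open Classical in
/-- The resolvent of `T`, as a bounded continuous function on `D` (and `0` if the resolvent
is not bounded on `D`). -/
def resolventBCF (D : Set ℂ) (T : X →L[ℂ] X) : D →ᵇ (X →L[ℂ] X) :=
  if h : ∃ M, ResolventBddOn D M T then
    BoundedContinuousFunction.ofNormedAddCommGroup (fun z : D => resolvent T (z : ℂ))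
      (((continuousOn_resolvent T).mono fun z hz => (h.choose_spec z hz).1).domRestrict) h.choose
      fun z => (h.choose_spec z z.2).2
  else 0

theorem resolventBCF_apply {D : Set ℂ} {M : ℝ} {T : X →L[ℂ] X} (h : ResolventBddOn D M T) (z : D) :
    resolventBCF D T z = resolvent T (z : ℂ) := by
  have h' : ∃ M, ResolventBddOn D M T := ⟨M, h⟩
  rw [resolventBCF, dif_pos h']
  rfl

theorem norm_resolventBCF_le {D : Set ℂ} {M : ℝ} (hM : 0 ≤ M) {T : X →L[ℂ] X}
    (h : ResolventBddOn D M T) : ‖resolventBCF D T‖ ≤ M := by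
  rw [BoundedContinuousFunction.norm_le hM]
  intro z
  rw [resolventBCF_apply h]
  exact (h z z.2).2

/-- A scale of Banach spaces `S 0 → S 1 → ⋯ → S N` on which the operators `q i t` act, and whose
resolvents are bounded on `D`. -/
structure OperatorScale {V : Type*} [NormedAddCommGroup V] [NormedSpace ℝ V] {S : ℕ → Type u}
    [∀ i, NormedAddCommGroup (S i)] [∀ i, NormedSpace ℂ (S i)] (N : ℕ) (O : Set V) (D : Set ℂ)
    (inc : ∀ i k, S i →L[ℂ] S k) (q : ∀ i, V → S i →L[ℂ] S i) : Prop where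
  isOpen : IsOpen O
  inc_self : ∀ i ≤ N, inc i i = .id ℂ (S i)
  inc_comp : ∀ i k l, i ≤ k → k ≤ l → l ≤ N → inc k l ∘L inc i k = inc i l
  q_inc : ∀ i k, i ≤ k → k ≤ N → ∀ t ∈ O, q k t ∘L inc i k = inc i k ∘L q i t
  resolvent_bdd : ∀ i ≤ N, ∃ M : ℝ, ∀ t ∈ O, ResolventBddOn D M (q i t)
  q_cont : ∀ i, Even i → i + 1 ≤ N → ContinuousOn (fun t => inc i (i + 1) ∘L q i t) O
  q_contDiff : ∀ i l k : ℕ, Odd i → 1 ≤ l → k + 1 = i + 2 * l → k ≤ N →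
    ContDiffOn ℝ l (fun t => inc i k ∘L q i t) O

namespace OperatorScale

variable {V : Type*} [NormedAddCommGroup V] [NormedSpace ℝ V] {S : ℕ → Type u}
  [∀ i, NormedAddCommGroup (S i)] [∀ i, NormedSpace ℂ (S i)] [∀ i, CompleteSpace (S i)] {N : ℕ}
  {O : Set V} {D : Set ℂ} {inc : ∀ i k, S i →L[ℂ] S k} {q : ∀ i, V → S i →L[ℂ] S i}

/-- The resolvents form a scale of operators on bounded functions of the spectral parameter. -/
theorem resolventScale (h : OperatorScale N O D inc q) :
    ResolventScale (S := fun i => D →ᵇ S i) N O (fun i k => bcfMap D (S i) (S k) (inc i k))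
      (fun i t => bcfMap D (S i) (S i) (q i t))
      (fun i t => bcfDiag (resolventBCF D (q i t))) where
  isOpen := h.isOpen
  inc_self i hi := by
    ext f z
    simp [h.inc_self i hi]
  inc_comp i k l hik hkl hl := by
    ext f z
    simp only [ContinuousLinearMap.comp_apply, bcfMap_apply]
    exact DFunLike.congr_fun (h.inc_comp i k l hik hkl hl) _
  q_inc i k hik hk t ht := by
    ext f z
    simp only [ContinuousLinearMap.comp_apply, bcfMap_apply]
    exact DFunLike.congr_fun (h.q_inc i k hik hk t ht) _
  r_inc i k hik hk t ht := by
    obtain ⟨M, hM⟩ := h.resolvent_bdd i (by omega)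
    obtain ⟨M', hM'⟩ := h.resolvent_bdd k (by omega)
    ext f z
    simp only [ContinuousLinearMap.comp_apply, bcfMap_apply, bcfDiag_apply,
      resolventBCF_apply (hM t ht), resolventBCF_apply (hM' t ht)]
    have h1 := smul_resolvent_apply_sub (hM t ht z z.2).1 (f z)
    have h2 := resolvent_apply_sub (hM' t ht z z.2).1 (inc i k (resolvent (q i t) (z : ℂ) (f z)))
    have h3 := DFunLike.congr_fun (h.q_inc i k hik hk t ht) (resolvent (q i t) (z : ℂ) (f z))
    simp only [ContinuousLinearMap.comp_apply] at h3
    rwa [h3, ← map_smul, ← map_sub, h1] at h2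
  r_bdd i hi := by
    obtain ⟨M, hM⟩ := h.resolvent_bdd i hi
    exact ⟨max M 0, fun t ht => (norm_bcfDiag_le _).trans (norm_resolventBCF_le (le_max_right _ _)
      fun z hz => ⟨(hM t ht z hz).1, (hM t ht z hz).2.trans (le_max_left _ _)⟩)⟩
  resolvent_eq i hi s hs t ht := by
    obtain ⟨M, hM⟩ := h.resolvent_bdd i hi
    ext f z
    have := spectrum.resolvent_sub_resolvent (hM s hs z z.2).1 (hM t ht z z.2).1
    have := DFunLike.congr_fun this (f z)
    simpa [resolventBCF_apply (hM t ht), resolventBCF_apply (hM s hs)] using this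
  q_cont i hi hiN := by
    refine ((bcfMap D (S i) (S (i + 1))).continuous.comp_continuousOn (h.q_cont i hi hiN)).congr ?_
    intro t ht
    rfl
  q_contDiff i l k hi hl hk hkN := by
    refine (((bcfMap D (S i) (S k)).restrictScalars ℝ).contDiff.comp_contDiffOn
      (h.q_contDiff i l k hi hl hk hkN)).congr ?_
    intro t ht
    rfl

/-- The resolvents, as functions of the perturbation parameter with values in the operators on
bounded functions of the spectral parameter. -/
def uniformResolvent (D : Set ℂ) (inc : ∀ i k, S i →L[ℂ] S k) (q : ∀ i, V → S i →L[ℂ] S i)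
    (N : ℕ) (t : V) : (D →ᵇ S 0) →L[ℂ] (D →ᵇ S N) :=
  bcfMap D (S 0) (S N) (inc 0 N) ∘L bcfDiag (resolventBCF D (q 0 t))

theorem contDiffOn_uniformResolvent [FiniteDimensional ℝ V] {m : ℕ}
    (h : OperatorScale (2 * m + 1) O D inc q) :
    ContDiffOn ℝ m (uniformResolvent D inc q (2 * m + 1)) O :=
  h.resolventScale.contDiffOn_r m 0 (2 * m + 1) (by simp) (by omega) le_rfl

theorem bcfCompress_eval_uniformResolvent (h : OperatorScale N O D inc q) {t : V} (ht : t ∈ O)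
    (z : D) :
    bcfCompress (BoundedContinuousFunction.evalCLM ℂ z) (uniformResolvent D inc q N t)
      = inc 0 N ∘L resolvent (q 0 t) (z : ℂ) := by
  obtain ⟨M, hM⟩ := h.resolvent_bdd 0 (by omega)
  ext f
  simp [uniformResolvent, resolventBCF_apply (hM t ht)]

theorem bcfCompress_contourMoment_uniformResolvent (h : OperatorScale N O D inc q) {t : V}
    (ht : t ∈ O) {r : ℝ} (hr : 0 < r) (hD : Metric.sphere (0 : ℂ) r ⊆ D) (n : ℤ) :
    bcfCompress (contourMoment (S N) hr hD n) (uniformResolvent D inc q N t)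
      = inc 0 N ∘L rieszMoment r (q 0 t) n := by
  obtain ⟨M, hM⟩ := h.resolvent_bdd 0 (by omega)
  ext f
  have hs : Metric.sphere (0 : ℂ) r ⊆ resolventSet ℂ (q 0 t) := fun z hz => (hM t ht z (hD hz)).1
  have hi : CircleIntegrable (fun z => z ^ n • resolvent (q 0 t) z f) 0 r := by
    refine ContinuousOn.circleIntegrable hr.le (ContinuousOn.fun_smul ?_
      (((continuousOn_resolvent _).mono hs).clm_apply continuousOn_const))
    exact fun z hz => (continuousAt_zpow₀ z n
      (Or.inl (Metric.ne_of_mem_sphere hz hr.ne'))).continuousWithinAt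
  rw [bcfCompress_apply, contourMoment_apply, ContinuousLinearMap.comp_apply,
    rieszMoment_apply hr hs, map_smul, ← (inc 0 N).circleIntegral_comp_comm hi]
  congr 1
  refine circleIntegral.integral_congr hr.le fun z hz => ?_
  simp [extendZero_of_mem _ (hD hz), uniformResolvent, resolventBCF_apply (hM t ht)]

end OperatorScale

end UniformResolvent

/-! ### Bounds on partial derivatives -/

section PartialDeriv

variable {d : ℕ} {F G : Type*} [NormedAddCommGroup F] [NormedSpace ℝ F] [NormedAddCommGroup G]
  [NormedSpace ℝ G]

theorem ContDiffOn.of_eq_clm_comp {V : Type*} [NormedAddCommGroup V] [NormedSpace ℝ V]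
    {n : WithTop ℕ∞} {O : Set V} {f : V → F} (hf : ContDiffOn ℝ n f O) {g : V → G} (L : F →L[ℝ] G)
    (hg : ∀ t ∈ O, g t = L (f t)) : ContDiffOn ℝ n g O :=
  (L.contDiff.comp_contDiffOn hf).congr hg

theorem norm_partialDeriv_le (ℓ : ℕ) (i : Fin ℓ → Fin d) (f : EuclideanSpace ℝ (Fin d) → F)
    (t : EuclideanSpace ℝ (Fin d)) : ‖partialDeriv ℓ i f t‖ ≤ ‖iteratedFDeriv ℝ ℓ f t‖ := by
  refine (ContinuousMultilinearMap.le_opNorm _ _).trans ?_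
  simp

theorem norm_partialDeriv_le_of_eq_comp {m : ℕ} {O : Set (EuclideanSpace ℝ (Fin d))}
    (hO : IsOpen O) {f : EuclideanSpace ℝ (Fin d) → F} (hf : ContDiffOn ℝ m f O)
    {g : EuclideanSpace ℝ (Fin d) → G} (L : F →L[ℝ] G) (hg : ∀ t ∈ O, g t = L (f t)) {ℓ : ℕ}
    (hℓ : ℓ ≤ m) (i : Fin ℓ → Fin d) {t : EuclideanSpace ℝ (Fin d)} (ht : t ∈ O) :
    ‖partialDeriv ℓ i g t‖ ≤ ‖L‖ * ‖iteratedFDeriv ℝ ℓ f t‖ := by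
  refine (norm_partialDeriv_le ℓ i g t).trans ?_
  have he : g =ᶠ[𝓝 t] fun t => L (f t) := by
    filter_upwards [hO.mem_nhds ht] with s hs using hg s hs
  rw [(he.iteratedFDeriv ℝ ℓ).eq_of_nhds]
  exact L.norm_iteratedFDeriv_comp_left (hf.contDiffAt (hO.mem_nhds ht)) (by exact_mod_cast hℓ)

/-- Derivatives continuous at `x` are bounded near `x`; the sum of the finitely many bounds serves
all orders. -/
theorem exists_open_iteratedFDeriv_bdd {V : Type*} [NormedAddCommGroup V] [NormedSpace ℝ V]
    {m : ℕ} {O : Set V} (hO : IsOpen O) {f : V → F} (hf : ContDiffOn ℝ m f O) {x : V}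
    (hx : x ∈ O) : ∃ O' ⊆ O, IsOpen O' ∧ x ∈ O' ∧ ∃ C : ℝ, ∀ ℓ ≤ m, ∀ t ∈ O',
      ‖iteratedFDeriv ℝ ℓ f t‖ ≤ C := by
  have hev : ∀ ℓ ∈ Finset.range (m + 1), ∀ᶠ t in 𝓝 x,
      ‖iteratedFDeriv ℝ ℓ f t‖ ≤ ‖iteratedFDeriv ℝ ℓ f x‖ + 1 := by
    intro ℓ hℓ
    have hc : ContinuousAt (iteratedFDeriv ℝ ℓ f) x := by
      have h1 := (hf.continuousOn_iteratedFDerivWithin (m := ℓ)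
        (by exact_mod_cast Finset.mem_range_succ_iff.1 hℓ) hO.uniqueDiffOn).continuousAt
        (hO.mem_nhds hx)
      refine h1.congr ?_
      filter_upwards [hO.mem_nhds hx] with t ht using iteratedFDerivWithin_of_isOpen ℓ hO ht
    exact (hc.norm.tendsto.eventually_le_const (lt_add_one _))
  have h2 := (Filter.eventually_all_finset _).2 hev
  obtain ⟨O', hO', hO'o, hxO'⟩ := mem_nhds_iff.1 (h2.and (hO.mem_nhds hx))
  refine ⟨O', fun t ht => (hO' ht).2, hO'o, hxO',
    ∑ ℓ ∈ Finset.range (m + 1), (‖iteratedFDeriv ℝ ℓ f x‖ + 1), fun ℓ hℓ t ht => ?_⟩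
  exact ((hO' ht).1 ℓ (Finset.mem_range_succ_iff.2 hℓ)).trans
    (Finset.single_le_sum (f := fun ℓ => ‖iteratedFDeriv ℝ ℓ f x‖ + 1)
      (fun _ _ => by positivity) (Finset.mem_range_succ_iff.2 hℓ))

end PartialDeriv

/-! ### Function spaces and Fourier kernels -/

section FunctionSpaces

variable {E : Type u} [MeasurableSpace E] {π : Measure E} {d : ℕ}

namespace FunctionSpace

theorem ae_le_eqv (B : FunctionSpace π) : ae π ≤ B.eqv := by
  rcases B.eqv_eq with h | h <;> rw [h]
  exact le_top

theorem toFn_add_ae (B : FunctionSpace π) (f g : B) :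
    B.toFn (f + g) =ᵐ[π] B.toFn f + B.toFn g := B.ae_le_eqv (B.toFn_add f g)

theorem toFn_smul_ae (B : FunctionSpace π) (c : ℂ) (f : B) :
    B.toFn (c • f) =ᵐ[π] c • B.toFn f := B.ae_le_eqv (B.toFn_smul c f)

theorem toFn_zero (B : FunctionSpace π) : B.toFn 0 =ᶠ[B.eqv] fun _ => 0 := by
  have := B.toFn_smul 0 0
  simpa only [zero_smul, zero_mul] using this

/-- The canonical map into `L¹(π)`. -/
def toLp (B : FunctionSpace π) : B →L[ℂ] (E →₁[π] ℂ) :=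
  LinearMap.mkContinuousOfExistsBound
    { toFun := fun f => (B.integrable f).toL1 (B.toFn f)
      map_add' := fun f g => by
        rw [← Integrable.toL1_add, Integrable.toL1_eq_toL1_iff]
        exact B.toFn_add_ae f g
      map_smul' := fun c f => by
        rw [RingHom.id_apply, ← Integrable.toL1_smul', Integrable.toL1_eq_toL1_iff]
        exact B.toFn_smul_ae c f } <| by
    obtain ⟨C, hC⟩ := B.embeds_L1
    refine ⟨C, fun f => ?_⟩
    exact (L1.norm_of_fun_eq_integral_norm (B.integrable f)).trans_le (hC f)

theorem norm_toLp (B : FunctionSpace π) (f : B) : ‖B.toLp f‖ = B.normL1 f :=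
  L1.norm_of_fun_eq_integral_norm (B.integrable f)

/-- The linear form `f ↦ π(f)`. -/
def mean (B : FunctionSpace π) : B →L[ℂ] ℂ :=
  LinearMap.mkContinuousOfExistsBound
    { toFun := fun f => ∫ x, B.toFn f x ∂π
      map_add' := fun f g => by
        rw [integral_congr_ae (B.toFn_add_ae f g)]
        exact integral_add (B.integrable f) (B.integrable g)
      map_smul' := fun c f => by
        rw [integral_congr_ae (B.toFn_smul_ae c f)]
        exact integral_smul c _ } <| by
    obtain ⟨C, hC⟩ := B.embeds_L1
    exact ⟨C, fun f => (norm_integral_le_integral_norm _).trans (hC f)⟩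

theorem mean_apply (B : FunctionSpace π) (f : B) : B.mean f = ∫ x, B.toFn f x ∂π := rfl

theorem norm_mean_le (B : FunctionSpace π) (f : B) : ‖B.mean f‖ ≤ ‖B.toLp f‖ := by
  rw [norm_toLp]
  exact norm_integral_le_integral_norm _

/-- The constant function `1`. -/
def one (B : FunctionSpace π) : B := B.one_mem.choose

theorem toFn_one (B : FunctionSpace π) : B.toFn B.one =ᶠ[B.eqv] fun _ => 1 := B.one_mem.choose_spec

theorem mean_one [IsProbabilityMeasure π] (B : FunctionSpace π) : B.mean B.one = 1 := by
  rw [mean_apply, integral_congr_ae (B.ae_le_eqv B.toFn_one)]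
  simp

end FunctionSpace

section Inclusion

variable {B X Y : FunctionSpace π}

theorem IsInclusion.unique {ι ι' : B →L[ℂ] X} (h : IsInclusion B X ι) (h' : IsInclusion B X ι') :
    ι = ι' := by
  ext f
  exact X.toFn_inj _ _ ((h.2 f).trans (h'.2 f).symm)

theorem IsInclusion.id (B : FunctionSpace π) : IsInclusion B B (.id ℂ B) :=
  ⟨le_rfl, fun _ => EventuallyEq.rfl⟩

theorem IsInclusion.comp {ι' : X →L[ℂ] Y} {ι : B →L[ℂ] X} (h' : IsInclusion X Y ι')
    (h : IsInclusion B X ι) : IsInclusion B Y (ι' ∘L ι) :=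
  ⟨h'.1.trans h.1, fun f => (h'.2 _).trans ((h.2 f).filter_mono h'.1)⟩

theorem Embeds.isInclusion (h : Embeds B X) : IsInclusion B X h.incl := h.choose_spec

theorem Embeds.refl (B : FunctionSpace π) : Embeds B B := ⟨_, IsInclusion.id B⟩

theorem Embeds.trans (h : Embeds B X) (h' : Embeds X Y) : Embeds B Y :=
  ⟨_, h'.isInclusion.comp h.isInclusion⟩

theorem IsInclusion.mean_comp {ι : B →L[ℂ] X} (h : IsInclusion B X ι) (f : B) :
    X.mean (ι f) = B.mean f :=
  integral_congr_ae (X.ae_le_eqv (h.2 f))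

open Classical in
/-- The inclusion of `B` into `X` (and `0` if there is none). -/
def inclusionOrZero (B X : FunctionSpace π) : B →L[ℂ] X := if h : Embeds B X then h.incl else 0

theorem Embeds.isInclusion_inclusionOrZero (h : Embeds B X) :
    IsInclusion B X (inclusionOrZero B X) := by
  rw [inclusionOrZero, dif_pos h]
  exact h.isInclusion

end Inclusion

section Fourier

variable {Q : Kernel E E} {ξ : E → EuclideanSpace ℝ (Fin d)} {B X : FunctionSpace π}
  {t : EuclideanSpace ℝ (Fin d)}

/-- For classes modulo `π`: by invariance, a `π`-null set is `Q(x, ·)`-null for `π`-almost every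
`x`, so `Q(t)` is well defined on classes. -/
theorem fourierKernel_congr (hπ : Q.Invariant π) {F : Filter E} (hF : F = ⊤ ∨ F = ae π)
    {f g : E → ℂ} (h : f =ᶠ[F] g) : fourierKernel Q ξ t f =ᶠ[F] fourierKernel Q ξ t g := by
  rcases hF with rfl | rfl
  · rw [eventuallyEq_top] at h
    rw [h]
  · rw [← hπ.def] at h
    filter_upwards [Measure.ae_ae_of_ae_comp h] with x hx
    refine integral_congr_ae ?_
    filter_upwards [hx] with y hy
    rw [hy]

theorem IsFourierOp.unique {T T' : B →L[ℂ] X} (h : IsFourierOp Q ξ B X t T)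
    (h' : IsFourierOp Q ξ B X t T') : T = T' := by
  ext f
  exact X.toFn_inj _ _ ((h f).trans (h' f).symm)

theorem FourierActs.isFourierOp (h : FourierActs Q ξ B X t) :
    IsFourierOp Q ξ B X t (fourierOp Q ξ B X t) := by
  rw [fourierOp, dif_pos h]
  exact h.choose_spec

theorem FourierActs.inclusion_comp (h : FourierActs Q ξ B B t) {ι : B →L[ℂ] X}
    (hι : IsInclusion B X ι) : IsFourierOp Q ξ B X t (ι ∘L fourierOp Q ξ B B t) := fun f =>
  (hι.2 _).trans ((h.isFourierOp f).filter_mono hι.1)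

theorem FourierActs.comp_inclusion (hπ : Q.Invariant π) (h : FourierActs Q ξ X X t)
    {ι : B →L[ℂ] X} (hι : IsInclusion B X ι) :
    IsFourierOp Q ξ B X t (fourierOp Q ξ X X t ∘L ι) := fun f =>
  (h.isFourierOp (ι f)).trans (fourierKernel_congr hπ X.eqv_eq (hι.2 f))

theorem fourierOp_eq_inclusion_comp (h : FourierActs Q ξ B B t) {ι : B →L[ℂ] X}
    (hι : IsInclusion B X ι) : fourierOp Q ξ B X t = ι ∘L fourierOp Q ξ B B t :=
  IsFourierOp.unique (FourierActs.isFourierOp ⟨_, h.inclusion_comp hι⟩) (h.inclusion_comp hι)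

theorem fourierOp_comp_inclusion (hπ : Q.Invariant π) (hB : FourierActs Q ξ B B t)
    (hX : FourierActs Q ξ X X t) {ι : B →L[ℂ] X} (hι : IsInclusion B X ι) :
    fourierOp Q ξ X X t ∘L ι = ι ∘L fourierOp Q ξ B B t :=
  (hX.comp_inclusion hπ hι).unique (hB.inclusion_comp hι)

/-- `|Q(t) f| ≤ Q|f|` since the exponential has modulus one, and `π Q = π`. This is the weak
contraction that the Doeblin–Fortet setting requires. -/
theorem lintegral_fourierKernel_le (hπ : Q.Invariant π) {f : E → ℂ} (hf : Integrable f π) :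
    ∫⁻ x, ‖fourierKernel Q ξ t f x‖ₑ ∂π ≤ ∫⁻ x, ‖f x‖ₑ ∂π := by
  have hm : AEMeasurable (fun x => ‖f x‖ₑ) (π.bind Q) := by
    rw [hπ.def]
    exact hf.aestronglyMeasurable.enorm
  calc ∫⁻ x, ‖fourierKernel Q ξ t f x‖ₑ ∂π ≤ ∫⁻ x, ∫⁻ y, ‖f y‖ₑ ∂(Q x) ∂π := by
        refine lintegral_mono fun x => (enorm_integral_le_lintegral_enorm _).trans_eq ?_
        refine lintegral_congr fun y => ?_
        rw [enorm_mul, mul_comm Complex.I, ← ofReal_norm (Complex.exp _),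
          Complex.norm_exp_ofReal_mul_I, ENNReal.ofReal_one, one_mul]
    _ = ∫⁻ x, ‖f x‖ₑ ∂(π.bind Q) := (Measure.lintegral_bind Q.aemeasurable hm).symm
    _ = _ := by rw [hπ.def]

theorem FourierActs.normL1_le (hπ : Q.Invariant π) (h : FourierActs Q ξ B B t) (f : B) :
    B.normL1 (fourierOp Q ξ B B t f) ≤ B.normL1 f := by
  rw [FunctionSpace.normL1, FunctionSpace.normL1,
    integral_norm_eq_lintegral_enorm (B.integrable _).aestronglyMeasurable,
    integral_norm_eq_lintegral_enorm (B.integrable _).aestronglyMeasurable]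
  refine ENNReal.toReal_mono (B.integrable f).hasFiniteIntegral.ne ?_
  refine le_trans (le_of_eq ?_) (lintegral_fourierKernel_le (ξ := ξ) (t := t) hπ (B.integrable f))
  refine lintegral_congr_ae ?_
  filter_upwards [B.ae_le_eqv (h.isFourierOp f)] with x hx
  rw [hx]

theorem fourierOp_zero_one [IsMarkovKernel Q] (hπ : Q.Invariant π)
    (h : FourierActs Q ξ B B 0) : fourierOp Q ξ B B 0 B.one = B.one := by
  refine B.toFn_inj _ _ ((h.isFourierOp B.one).trans ?_)
  refine (fourierKernel_congr hπ B.eqv_eq B.toFn_one).trans (EventuallyEq.trans ?_ B.toFn_one.symm)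
  refine Eventually.of_forall fun x => ?_
  simp [fourierKernel]

/-- Hypothesis (K) yields uniform bounds on the resolvents, and a dominating eigenvalue. -/
theorem HypothesisK.exists_resolvent_bdd [IsMarkovKernel Q] [IsProbabilityMeasure π]
    (hπ : Q.Invariant π) (hK : HypothesisK Q ξ B) :
    ∃ κ₀ < 1, ∀ κ : ℝ, κ₀ < κ → κ < 1 →
      (∃ M : ℝ, ∀ᶠ t in 𝓝 0, FourierActs Q ξ B B t ∧
        ResolventBddOn (resolventDomain κ) M (fourierOp Q ξ B B t)) ∧
      ∀ᶠ t in 𝓝 0, B.mean (rieszProj κ (fourierOp Q ξ B B t) B.one) ≠ 0 ∧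
        IsDominatingEigenpair (fourierOp Q ξ B B t)
          (rieszEigenvalue κ B.mean B.one (fourierOp Q ξ B B t))
          (rieszProj κ (fourierOp Q ξ B B t)) ∧
        ∀ n : ℕ, 1 ≤ n →
          (fourierOp Q ξ B B t - rieszEigenvalue κ B.mean B.one (fourierOp Q ξ B B t) •
            rieszProj κ (fourierOp Q ξ B B t)) ^ n = rieszMoment κ (fourierOp Q ξ B B t) n := by
  obtain ⟨O, hO, h0, hacts, ⟨P, hP, hlim⟩, hcont, κ₁, C, hκ₁, hκ₁', hC, hDF⟩ := hK
  have hO0 : O ∈ 𝓝 (0 : EuclideanSpace ℝ (Fin d)) := hO.mem_nhds h0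
  have hDF' : ∀ t ∈ O, DoeblinFortet (weakSeminorm B.toLp) κ₁ C (fourierOp Q ξ B B t) := by
    refine fun t ht => ⟨fun f => ?_, fun n hn f => ?_⟩
    · simpa only [weakSeminorm_apply, B.norm_toLp] using (hacts t ht).normL1_le hπ f
    · simpa only [weakSeminorm_apply, B.norm_toLp] using hDF n hn f t ht
  have hDFe : ∀ᶠ t in 𝓝 (0 : EuclideanSpace ℝ (Fin d)),
      DoeblinFortet (weakSeminorm B.toLp) κ₁ C (fourierOp Q ξ B B t) := by
    filter_upwards [hO0] with t ht using hDF' t ht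
  obtain ⟨κ₀, hκ₀, hκ₀', hKL⟩ := keller_liverani (l := 𝓝 (0 : EuclideanSpace ℝ (Fin d))) hκ₁ hκ₁'
    hC.le (norm_nonneg B.toLp) (p := weakSeminorm B.toLp) (fun f => B.toLp.le_opNorm f)
    (hDF' 0 h0) hDFe hlim fun ε hε => by
      filter_upwards [hcont 0 h0 ε hε] with t ht f
      simpa only [weakSeminorm_apply, B.norm_toLp, zero_add] using ht f
  refine ⟨κ₀, hκ₀, fun κ hκ hκ1 => ?_⟩
  obtain ⟨hrate, M, hM0, hres₀, hres, hweak⟩ := hKL κ hκ hκ1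
  refine ⟨⟨M, ?_⟩, ?_⟩
  · filter_upwards [hO0, hres] with t ht hrt using ⟨hacts t ht, hrt⟩
  · refine eventually_isDominatingEigenpair hκ₁ hC.le (hκ₀'.trans_lt hκ) hκ1 hM0 hDFe hres₀ hres
      hweak (mul_eq_of_tendsto_pow hlim) hrate B.norm_mean_le (fun f hf => ?_)
      (fourierOp_zero_one hπ (hacts 0 h0)) B.mean_one
    refine B.toFn_inj _ _ ((hP f).trans (EventuallyEq.trans ?_ B.toFn_zero.symm))
    rw [FunctionSpace.mean_apply] at hf
    rw [hf]

end Fourier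

end FunctionSpaces

/-! ### Assembly -/

section Assembly

variable {E : Type u} [MeasurableSpace E] {π : Measure E} {d : ℕ}

/-- The points `a, T₀ a, T₁ T₀ a, T₀ T₁ T₀ a, …`. -/
def alternatingOrbit (T₀ T₁ : ℝ → ℝ) (a : ℝ) : ℕ → ℝ
  | 0 => a
  | n + 1 => if Even n then T₀ (alternatingOrbit T₀ T₁ a n) else T₁ (alternatingOrbit T₀ T₁ a n)

section Orbit

variable (T₀ T₁ : ℝ → ℝ) (a : ℝ)

theorem alternatingOrbit_succ_of_even {n : ℕ} (h : Even n) :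
    alternatingOrbit T₀ T₁ a (n + 1) = T₀ (alternatingOrbit T₀ T₁ a n) := if_pos h

theorem alternatingOrbit_succ_of_odd {n : ℕ} (h : Odd n) :
    alternatingOrbit T₀ T₁ a (n + 1) = T₁ (alternatingOrbit T₀ T₁ a n) :=
  if_neg (Nat.not_even_iff_odd.2 h)

theorem alternatingOrbit_add_two_mul {n : ℕ} (h : Odd n) (j : ℕ) :
    alternatingOrbit T₀ T₁ a (n + 2 * j) = (T₀ ∘ T₁)^[j] (alternatingOrbit T₀ T₁ a n) := by
  induction j with
  | zero => rfl
  | succ j ih =>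
    rw [Function.iterate_succ_apply', ← ih, Function.comp_apply,
      ← alternatingOrbit_succ_of_odd T₀ T₁ a (by grind : Odd (n + 2 * j)),
      ← alternatingOrbit_succ_of_even T₀ T₁ a (by grind : Even (n + 2 * j + 1))]
    rfl

theorem alternatingOrbit_two_mul (j : ℕ) :
    alternatingOrbit T₀ T₁ a (2 * j) = (T₁ ∘ T₀)^[j] a := by
  induction j with
  | zero => rfl
  | succ j ih =>
    rw [Function.iterate_succ_apply', ← ih, Function.comp_apply,
      ← alternatingOrbit_succ_of_even T₀ T₁ a (by grind : Even (2 * j)),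
      ← alternatingOrbit_succ_of_odd T₀ T₁ a (by grind : Odd (2 * j + 1))]
    rfl

theorem alternatingOrbit_two_mul_add_one (j : ℕ) :
    alternatingOrbit T₀ T₁ a (2 * j + 1) = (T₀ ∘ T₁)^[j] (T₀ a) := by
  rw [add_comm, alternatingOrbit_add_two_mul T₀ T₁ a odd_one]
  rfl

end Orbit

variable {Q : Kernel E E} {ξ : E → EuclideanSpace ℝ (Fin d)}

/-- The scale of spaces extracted from Hypothesis `𝒞(m)`. -/
structure FourierScale (Q : Kernel E E) (ξ : E → EuclideanSpace ℝ (Fin d)) (N : ℕ)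
    (S : ℕ → FunctionSpace π) : Prop where
  embeds : ∀ i k, i ≤ k → k ≤ N → Embeds (S i) (S k)
  hypK : ∀ i ≤ N, HypothesisK Q ξ (S i)
  smooth : ∀ i ≤ N, ∃ V : Set (EuclideanSpace ℝ (Fin d)), IsOpen V ∧ 0 ∈ V ∧
    (Even i → i + 1 ≤ N → FourierContDiffOn Q ξ 0 V (S i) (S (i + 1))) ∧
    ∀ l k : ℕ, Odd i → 1 ≤ l → k + 1 = i + 2 * l → k ≤ N →
      FourierContDiffOn Q ξ l V (S i) (S k)

theorem HypothesisC.exists_fourierScale {m : ℕ} {B B' : FunctionSpace π}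
    (hC : HypothesisC Q ξ m B B') :
    ∃ S : ℕ → FunctionSpace π, FourierScale Q ξ (2 * m + 1) S ∧ B = S 0 ∧ B' = S (2 * m + 1) := by
  obtain ⟨I, Bθ, T₀, T₁, -, hV, a, ha, rfl, rfl⟩ := hC
  set θ := alternatingOrbit T₀ T₁ a with hθ
  have hI : ∀ i ≤ 2 * m + 1, θ i ∈ I := by
    intro i hi
    rcases Nat.even_or_odd' i with ⟨k, rfl | rfl⟩
    · rw [hθ, alternatingOrbit_two_mul]
      exact (ha k (by omega)).2
    · rw [hθ, alternatingOrbit_two_mul_add_one]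
      exact (ha k (by omega)).1
  have heven : ∀ {i}, Even i → θ (i + 1) = T₀ (θ i) := alternatingOrbit_succ_of_even T₀ T₁ a
  have hodd : ∀ {i}, Odd i → θ (i + 1) = T₁ (θ i) := alternatingOrbit_succ_of_odd T₀ T₁ a
  have hstep : ∀ i, i + 1 ≤ 2 * m + 1 → Embeds (Bθ (θ i)) (Bθ (θ (i + 1))) := by
    intro i hi
    have hi1 := hI (i + 1) hi
    obtain ⟨V, -, -, h0, h1, -⟩ := hV (θ i) (hI i (by omega))
    rcases Nat.even_or_odd i with h | h
    · rw [heven h] at hi1 ⊢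
      exact h0 hi1
    · rw [hodd h] at hi1 ⊢
      exact h1 hi1
  refine ⟨fun i => Bθ (θ i), ⟨fun i k hik => ?_, fun i hi => ?_, fun i hi => ?_⟩, rfl,
    congrArg Bθ (alternatingOrbit_two_mul_add_one T₀ T₁ a m).symm⟩
  · induction k, hik using Nat.le_induction with
    | base => exact fun _ => Embeds.refl _
    | succ k _ ih => exact fun hk => (ih (by omega)).trans (hstep k hk)
  · obtain ⟨V, -, -, -, -, -, -, hK⟩ := hV (θ i) (hI i hi)
    exact hK
  · obtain ⟨V, hVo, hV0, -, -, h0, h1, -⟩ := hV (θ i) (hI i hi)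
    refine ⟨V, hVo, hV0, fun he hi1 => ?_, fun l k ho hl hk hkN => ?_⟩
    · have := hI (i + 1) hi1
      rw [heven he] at this
      simpa only [heven he] using h0 this
    · have horb : ∀ j, (T₀ ∘ T₁)^[j] (θ i) = θ (i + 2 * j) := fun j =>
        (alternatingOrbit_add_two_mul T₀ T₁ a ho j).symm
      have horb' : ∀ j, T₁ (θ (i + 2 * j)) = θ (i + 2 * j + 1) := fun j =>
        (hodd (by grind)).symm
      -- `l ≤ m` because `i ≥ 1` and `i + 2 l - 1 ≤ 2 m + 1`. The intermediate points are those of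
      -- the orbit, all in `I`, so the conditional requirement of `𝒞(m)` applies.
      have := h1 l hl (by grind) fun j hj => by
        rw [horb, horb']
        exact ⟨hI _ (by omega), hI _ (by omega)⟩
      rw [horb, horb', show i + 2 * (l - 1) + 1 = k by omega] at this
      exact this

namespace FourierScale

variable {N : ℕ} {S : ℕ → FunctionSpace π}

/-- Finitely many neighbourhoods are intersected; all compatibilities hold because an operator given
by an identity map, or by the kernel, is unique. -/
theorem exists_operatorScale [IsMarkovKernel Q] [IsProbabilityMeasure π] (hπ : Q.Invariant π)
    (h : FourierScale Q ξ N S) {κ : ℝ}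
    (hκ : ∀ i ≤ N, ∃ M : ℝ, ∀ᶠ t in 𝓝 0, FourierActs Q ξ (S i) (S i) t ∧
      ResolventBddOn (resolventDomain κ) M (fourierOp Q ξ (S i) (S i) t)) :
    ∃ O : Set (EuclideanSpace ℝ (Fin d)), 0 ∈ O ∧
      OperatorScale (S := fun i => S i) N O (resolventDomain κ)
        (fun i k => inclusionOrZero (S i) (S k)) (fun i => fourierOp Q ξ (S i) (S i)) ∧
      ∀ t ∈ O, FourierActs Q ξ (S 0) (S 0) t := by
  have hO : ∀ i, ∃ O : Set (EuclideanSpace ℝ (Fin d)), IsOpen O ∧ 0 ∈ O ∧ (i ≤ N →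
      (∀ t ∈ O, FourierActs Q ξ (S i) (S i) t) ∧
      (∃ M : ℝ, ∀ t ∈ O, ResolventBddOn (resolventDomain κ) M (fourierOp Q ξ (S i) (S i) t)) ∧
      (Even i → i + 1 ≤ N → FourierContDiffOn Q ξ 0 O (S i) (S (i + 1))) ∧
      ∀ l k : ℕ, Odd i → 1 ≤ l → k + 1 = i + 2 * l → k ≤ N →
        FourierContDiffOn Q ξ l O (S i) (S k)) := by
    intro i
    by_cases hi : i ≤ N
    · obtain ⟨V, hVo, hV0, hV1, hV2⟩ := h.smooth i hi
      obtain ⟨M, hM⟩ := hκ i hi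
      obtain ⟨O, hO, hOo, h0⟩ := mem_nhds_iff.1 (hM.and (hVo.mem_nhds hV0))
      have hsub : O ⊆ V := fun t ht => (hO ht).2
      have hmono : ∀ {l : ℕ} {X Y : FunctionSpace π}, FourierContDiffOn Q ξ l V X Y →
          FourierContDiffOn Q ξ l O X Y := fun hc =>
        ⟨fun t ht => hc.1 t (hsub ht), hc.2.mono hsub⟩
      exact ⟨O, hOo, h0, fun _ => ⟨fun t ht => (hO ht).1.1, ⟨M, fun t ht => (hO ht).1.2⟩,
        fun he hi1 => hmono (hV1 he hi1), fun l k ho hl hk hkN => hmono (hV2 l k ho hl hk hkN)⟩⟩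
    · exact ⟨univ, isOpen_univ, mem_univ _, fun h => absurd h hi⟩
  choose O hOo hO0 hOi using hO
  set U : Set (EuclideanSpace ℝ (Fin d)) := ⋂ i ∈ Finset.range (N + 1), O i
  have hUO : ∀ i ≤ N, U ⊆ O i := fun i hi =>
    biInter_subset_of_mem (Finset.mem_coe.2 (Finset.mem_range_succ_iff.2 hi))
  have hacts : ∀ i ≤ N, ∀ t ∈ U, FourierActs Q ξ (S i) (S i) t := fun i hi t ht =>
    (hOi i hi).1 t (hUO i hi ht)
  have hincl : ∀ i k, i ≤ k → k ≤ N →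
      IsInclusion (S i) (S k) (inclusionOrZero (S i) (S k)) := fun i k hik hk =>
    (h.embeds i k hik hk).isInclusion_inclusionOrZero
  have hcomp : ∀ i k, i ≤ k → k ≤ N → ∀ t ∈ U,
      inclusionOrZero (S i) (S k) ∘L fourierOp Q ξ (S i) (S i) t = fourierOp Q ξ (S i) (S k) t :=
    fun i k hik hk t ht =>
      (fourierOp_eq_inclusion_comp (hacts i (by omega) t ht) (hincl i k hik hk)).symm
  refine ⟨U, mem_iInter₂.2 fun i _ => hO0 i, ⟨?_, fun i hi => ?_, fun i k l hik hkl hl => ?_,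
    fun i k hik hk t ht => ?_, fun i hi => ?_, fun i he hi => ?_, fun i l k ho hl hk hkN => ?_⟩,
    hacts 0 (by omega)⟩
  · exact isOpen_biInter_finset fun i _ => hOo i
  · exact (hincl i i le_rfl hi).unique (IsInclusion.id _)
  · exact ((hincl k l hkl hl).comp (hincl i k hik (by omega))).unique (hincl i l (by omega) hl)
  · exact fourierOp_comp_inclusion hπ (hacts i (by omega) t ht) (hacts k hk t ht) (hincl i k hik hk)
  · obtain ⟨M, hM⟩ := (hOi i hi).2.1
    exact ⟨M, fun t ht => hM t (hUO i hi ht)⟩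
  · exact (((hOi i (by omega)).2.2.1 he hi).2.continuousOn.mono (hUO i (by omega))).congr
      (hcomp i (i + 1) (by omega) hi)
  · exact (((hOi i (by omega)).2.2.2 l k ho hl hk hkN).2.mono (hUO i (by omega))).congr
      (hcomp i k (by omega) hkN)

end FourierScale

theorem norm_evalCLM_le {D X : Type*} [TopologicalSpace D] [NormedAddCommGroup X] [NormedSpace ℂ X]
    (z : D) : ‖(BoundedContinuousFunction.evalCLM ℂ z : BoundedContinuousFunction D X →L[ℂ] X)‖
      ≤ 1 :=
  ContinuousLinearMap.opNorm_le_bound _ zero_le_one fun f => by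
    rw [one_mul]
    exact f.norm_coe_le_norm z

end Assembly

end

theorem proposition7p1 {E : Type u} [MeasurableSpace E] {d : ℕ} (hd : 1 ≤ d)
    (Q : Kernel E E) [IsMarkovKernel Q] (π : Measure E) [IsProbabilityMeasure π]
    (hπ : Q.Invariant π)
    (ξ : E → EuclideanSpace ℝ (Fin d)) (hξ : Measurable ξ) (hξi : Integrable ξ π)
    (hξ0 : ∫ x, ξ x ∂π = 0)
    (m : ℕ) (hm : 1 ≤ m) (B B' : FunctionSpace π) (hB : Embeds B B')
    (hC : HypothesisC Q ξ m B B')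
    (κa : ℝ) (hκa : κa ∈ Ioo (0 : ℝ) 1)
    (Ua : Set (EuclideanSpace ℝ (Fin d))) (hUa : Ua ∈ 𝓝 0) :
    ∃ κ ∈ Ioo κa 1, ∃ O : Set (EuclideanSpace ℝ (Fin d)), IsOpen O ∧ 0 ∈ O ∧ O ⊆ Ua ∧
      -- the resolvent
      (∀ t ∈ O, FourierActs Q ξ B B t ∧
        ∀ z ∈ resolventDomain κ, z ∈ resolventSet ℂ (fourierOp Q ξ B B t)) ∧
      (∀ z ∈ resolventDomain κ,
        ContDiffOn ℝ m (fun t => hB.incl ∘L resolvent (fourierOp Q ξ B B t) z) O) ∧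
      (∀ ℓ ≤ m, ∃ C : ℝ, ∀ z ∈ resolventDomain κ, ∀ t ∈ O, ∀ i : Fin ℓ → Fin d,
        ‖partialDeriv ℓ i (fun s => hB.incl ∘L resolvent (fourierOp Q ξ B B s) z) t‖ ≤ C) ∧
      -- the eigen-elements
      ∃ V ⊆ O, IsOpen V ∧ 0 ∈ V ∧
        ∃ (lam : EuclideanSpace ℝ (Fin d) → ℂ) (P : EuclideanSpace ℝ (Fin d) → (B →L[ℂ] B)),
          (∀ t ∈ V, IsDominatingEigenpair (fourierOp Q ξ B B t) (lam t) (P t)) ∧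
          ContDiffOn ℝ m (fun t => hB.incl ∘L P t) V ∧
          (∀ n : ℕ, 1 ≤ n →
            ContDiffOn ℝ m
              (fun t => hB.incl ∘L (fourierOp Q ξ B B t - lam t • P t) ^ n) V) ∧
          (∃ C > 0, ∀ n : ℕ, 1 ≤ n → ∀ ℓ ≤ m, ∀ t ∈ V, ∀ i : Fin ℓ → Fin d,
            ‖partialDeriv ℓ i
              (fun s => hB.incl ∘L (fourierOp Q ξ B B s - lam s • P s) ^ n) t‖ ≤ C * κ ^ n) ∧
          ContDiffOn ℝ m lam V := by
  obtain ⟨S, hS, rfl, rfl⟩ := hC.exists_fourierScale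
  have hK := fun i (hi : i ≤ 2 * m + 1) => (hS.hypK i hi).exists_resolvent_bdd hπ
  -- A single `κ` must serve all `2m + 2` spaces; each has a threshold below `1`, so any `κ` close
  -- enough to `1` will do.
  obtain ⟨κ, hκ, hκa', hκ1⟩ : ∃ κ : ℝ, (∀ i (hi : i ≤ 2 * m + 1), (hK i hi).choose < κ) ∧
      κa < κ ∧ κ < 1 := by
    have h1 : ∀ i ∈ Finset.range (2 * m + 2), ∀ᶠ κ in 𝓝[<] (1 : ℝ),
        ∀ hi : i ≤ 2 * m + 1, (hK i hi).choose < κ := by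
      intro i hi
      have hi' : i ≤ 2 * m + 1 := Finset.mem_range_succ_iff.1 hi
      filter_upwards [mem_nhdsWithin_of_mem_nhds (Ioi_mem_nhds (hK i hi').choose_spec.1)]
        with κ hκ _ using hκ
    have h2 : ∀ᶠ κ in 𝓝[<] (1 : ℝ), κa < κ :=
      mem_nhdsWithin_of_mem_nhds (Ioi_mem_nhds hκa.2)
    obtain ⟨κ, h3, h4, h5⟩ := (((Filter.eventually_all_finset _).2 h1).and
      (h2.and self_mem_nhdsWithin)).exists
    exact ⟨κ, fun i hi => h3 i (Finset.mem_range_succ_iff.2 hi) hi, h4, h5⟩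
  have hκ0 : 0 < κ := hκa.1.trans hκa'
  have hK' := fun i (hi : i ≤ 2 * m + 1) => (hK i hi).choose_spec.2 κ (hκ i hi) hκ1
  obtain ⟨O₁, hO₁0, hsc, hacts⟩ := hS.exists_operatorScale hπ fun i hi => (hK' i hi).1
  obtain ⟨O₂, hO₂, hO₂o, hO₂0⟩ := mem_nhds_iff.1 ((hK' 0 (by omega)).2.and hUa)
  set q := fun i => fourierOp Q ξ (S i) (S i)
  set inc : ∀ i k, (S i : Type u) →L[ℂ] (S k : Type u) := fun i k => inclusionOrZero (S i) (S k)
  have hincl : hB.incl = inc 0 (2 * m + 1) :=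
    hB.isInclusion.unique hB.isInclusion_inclusionOrZero
  set F := OperatorScale.uniformResolvent (resolventDomain κ) inc q (2 * m + 1)
  have hFc := hsc.contDiffOn_uniformResolvent
  -- `O₃` will serve both as `O` and as `V`, and `C` is behind every derivative bound.
  obtain ⟨O₃, hO₃, hO₃o, hO₃0, C, hCb⟩ := exists_open_iteratedFDeriv_bdd
    (hsc.isOpen.inter hO₂o) (hFc.mono inter_subset_left) ⟨hO₁0, hO₂0⟩
  have hO₃₁ : O₃ ⊆ O₁ := hO₃.trans inter_subset_left
  have hO₃₂ : O₃ ⊆ O₂ := hO₃.trans inter_subset_right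
  have hFc₃ : ContDiffOn ℝ m F O₃ := hFc.mono hO₃₁
  have hC0 : 0 ≤ C := (norm_nonneg _).trans (hCb 0 (Nat.zero_le _) 0 hO₃0)
  have hsub := sphere_self_subset_resolventDomain hκ1
  obtain ⟨M, hM⟩ := hsc.resolvent_bdd 0 (by omega)
  have heval : ∀ (z) (hz : z ∈ resolventDomain κ), ∀ t ∈ O₃,
      hB.incl ∘L resolvent (fourierOp Q ξ (S 0) (S 0) t) z
        = bcfCompress (BoundedContinuousFunction.evalCLM ℂ
          (⟨z, hz⟩ : resolventDomain κ)) (F t) := fun z hz t ht => by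
    rw [hincl]
    exact (hsc.bcfCompress_eval_uniformResolvent (hO₃₁ ht) ⟨z, hz⟩).symm
  have hmom : ∀ n : ℤ, ∀ t ∈ O₃,
      hB.incl ∘L rieszMoment κ (fourierOp Q ξ (S 0) (S 0) t) n
        = bcfCompress (contourMoment _ hκ0 hsub n) (F t) := fun n t ht => by
    rw [hincl]
    exact (hsc.bcfCompress_contourMoment_uniformResolvent (hO₃₁ ht) hκ0 hsub n).symm
  have hmomc : ∀ n : ℤ, ContDiffOn ℝ m
      (fun t => hB.incl ∘L rieszMoment κ (fourierOp Q ξ (S 0) (S 0) t) n) O₃ := fun n =>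
    hFc₃.of_eq_clm_comp (bcfCompress (contourMoment _ hκ0 hsub n)) (hmom n)
  have hprojc : ContDiffOn ℝ m
      (fun t => hB.incl ∘L rieszProj κ (fourierOp Q ξ (S 0) (S 0) t)) O₃ := by
    refine (contDiffOn_const (c := hB.incl)).sub (hmomc 0) |>.congr fun t ht => ?_
    rw [rieszProj, ContinuousLinearMap.comp_sub]
    rfl
  -- `Q(·)` is `C^m` from `S 1` to `S (2m)`; composing with `S 0 → S 1` and `S (2m) → S (2m+1)`
  -- gives the regularity from `B` to `B'`.
  have hopc : ContDiffOn ℝ m (fun t => hB.incl ∘L fourierOp Q ξ (S 0) (S 0) t) O₃ := by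
    have h1 := ((hsc.q_contDiff 1 m (2 * m) odd_one hm (by omega) (by omega)).mono hO₃₁)
    refine ((h1.comp_op_right (inc 0 1)).comp_op_left (inc (2 * m) (2 * m + 1))).congr
      fun t ht => ?_
    rw [hincl, ContinuousLinearMap.comp_assoc, hsc.q_inc 0 1 (by omega) (by omega) t (hO₃₁ ht),
      ← ContinuousLinearMap.comp_assoc, ← ContinuousLinearMap.comp_assoc,
      hsc.inc_comp 1 (2 * m) (2 * m + 1) (by omega) (by omega) le_rfl,
      hsc.inc_comp 0 1 (2 * m + 1) (by omega) (by omega) le_rfl]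
  have hpow : ∀ t ∈ O₃, ∀ n : ℕ, 1 ≤ n → _ := fun t ht => (hO₂ (hO₃₂ ht)).1.2.2
  refine ⟨κ, ⟨hκa', hκ1⟩, O₃, hO₃o, hO₃0, fun t ht => (hO₂ (hO₃₂ ht)).2, fun t ht =>
    ⟨hacts t (hO₃₁ ht), fun z hz => (hM t (hO₃₁ ht) z hz).1⟩, fun z hz => ?_, fun ℓ hℓ =>
    ⟨C, fun z hz t ht i => ?_⟩, O₃, subset_rfl, hO₃o, hO₃0,
    fun t => rieszEigenvalue κ (S 0).mean (S 0).one (fourierOp Q ξ (S 0) (S 0) t),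
    fun t => rieszProj κ (fourierOp Q ξ (S 0) (S 0) t), fun t ht => (hO₂ (hO₃₂ ht)).1.2.1,
    hprojc, fun n hn => ?_, ⟨κ * C + 1, by positivity, fun n hn ℓ hℓ t ht i => ?_⟩, ?_⟩
  · exact hFc₃.of_eq_clm_comp _ (heval z hz)
  · refine (norm_partialDeriv_le_of_eq_comp hO₃o hFc₃ _ (heval z hz) hℓ i ht).trans ?_
    calc _ ≤ 1 * C := mul_le_mul ((norm_bcfCompress_le _).trans (norm_evalCLM_le _))
          (hCb ℓ hℓ t ht) (norm_nonneg _) zero_le_one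
      _ = C := one_mul C
  · exact (hmomc n).congr fun t ht => by rw [hpow t ht n hn]
  · refine (norm_partialDeriv_le_of_eq_comp hO₃o hFc₃
      (bcfCompress (contourMoment _ hκ0 hsub n)) (fun s hs => ?_) hℓ i ht).trans ?_
    · rw [hpow s hs n hn, hmom n s hs]
    · calc _ ≤ κ * κ ^ (n : ℤ) * C :=
            mul_le_mul ((norm_bcfCompress_le _).trans (norm_contourMoment_le _ _ _))
              (hCb ℓ hℓ t ht) (norm_nonneg _) (by positivity)
        _ = κ * C * κ ^ n := by rw [zpow_natCast]; ring
        _ ≤ (κ * C + 1) * κ ^ n := by gcongr; linarith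
  -- `π` can be evaluated after inclusion in `B'`, where regularity is known. The product `Q(t)
  -- Π(t)` is replaced by `Q(t) - J_1(t)`, whose two terms are each of class `C^m`.
  · have happ : ∀ {G : EuclideanSpace ℝ (Fin d) → (S 0 →L[ℂ] S (2 * m + 1))},
        ContDiffOn ℝ m G O₃ → ContDiffOn ℝ m (fun t => (S (2 * m + 1)).mean (G t (S 0).one)) O₃ :=
      fun {G} hG => (((ContinuousLinearMap.apply ℂ ℂ (S 0).one).restrictScalars ℝ).contDiff
        ).comp_contDiffOn (hG.comp_op_left (S (2 * m + 1)).mean)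
    have hnum := (happ hopc).sub (happ (hmomc 1))
    have hden := happ hprojc
    refine (hnum.mul (hden.inv fun t ht => ?_)).congr fun t ht => ?_
    · rw [ContinuousLinearMap.comp_apply, hB.isInclusion.mean_comp]
      exact (hO₂ (hO₃₂ ht)).1.1
    · have hs : Metric.sphere (0 : ℂ) κ ⊆ resolventSet ℂ (fourierOp Q ξ (S 0) (S 0) t) :=
        fun z hz => (hM t (hO₃₁ ht) z (hsub hz)).1
      have e : fourierOp Q ξ (S 0) (S 0) t (rieszProj κ (fourierOp Q ξ (S 0) (S 0) t) (S 0).one)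
          = fourierOp Q ξ (S 0) (S 0) t (S 0).one
            - rieszMoment κ (fourierOp Q ξ (S 0) (S 0) t) 1 (S 0).one := by
        rw [rieszProj, sub_apply, one_apply_eq_self, map_sub, ← mul_apply_eq_comp _ _ (S 0).one,
          mul_rieszMoment hκ0 hs, if_neg (by norm_num), sub_zero, zero_add]
      simp only [ContinuousLinearMap.comp_apply, hB.isInclusion.mean_comp]
      rw [rieszEigenvalue, e, map_sub, div_eq_mul_inv]
      rfl
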